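/- Let $D$ be the open unit disk in $\mathbb{C}$ and let $dA$ be Lebesgue area measure on $D$, normalized so that $A(D)=1$. Write $\|\cdot\|_p$ for the norm of $L^p(D,dA)$ and $\langle f,g\rangle=\int_D f\bar g\,dA$. The Bergman space $L^2_a$ is the Hilbert space of analytic functions on $D$ that belong to $L^2(D,dA)$, and $P$ is the orthogonal projection of $L^2(D,dA)$ onto $L^2_a$. For $u\in L^\infty(D,dA)$ the Toeplitz operator $T_u\colon L^2_a\to L^2_a$ is defined by $T_uf=P(uf)$. For $z\in D$ let $K_z\in L^2_a$ be the reproducing kernel, i.e. $f(z)=\langle f,K_z\rangle$ for all $f\in L^2_a$, and let $k_z=K_z/\|K_z\|_2$. For a bounded operator $S$ on $L^2_a$ its Berezin transform is $\tilde S(z)=\langle Sk_z,k_z\rangle$, $z\in D$. For $z\in D$ let $\varphi_z(w)=\frac{z-w}{1-\bar z w}$, let $U_z\colon L^2_a\to L^2_a$ be the unitary operator $U_zf=(f\circ\varphi_z)\,\varphi_z'$, and let $S_z=U_zSU_z$. By $z\to\partial D$ we mean $|z|\to1$ with $z \in D$. Suppose $S$ is a finite sum of operators of the form $T_{u_1}\cdots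 T_{u_n}$, where each $u_j\in L^\infty(D,dA)$. Then the following are equivalent: (a) $S$ is compact; (b) $\|Sk_z\|_2\to0$ as $z\to\partial D$; (c) $\tilde S(z)\to0$ as $z\to\partial D$; (d) $S_z1\to0$ weakly in $L^2_a$ as $z\to\partial D$; (e) $\|S_z1\|_2\to0$ as $z\to\partial D$; (f) $\|S_z1\|_p\to0$ as $z\to\partial D$ for every $p\in(1,\infty)$. -/

import Mathlib

open MeasureTheory Complex Metric Filter Topology Set
open scoped ENNReal ComplexConjugate Complex.UnitDisc

namespace Bergman

/-- Lebesgue area measure on the open unit disk, normalized to have total mass `1`. -/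
noncomputable def dA : Measure ℂ :=
  (ENNReal.ofReal Real.pi)⁻¹ • volume.restrict (ball (0 : ℂ) 1)

lemma ofReal_pi_ne_zero : ENNReal.ofReal Real.pi ≠ 0 := by simp [Real.pi_pos]

lemma coe_nnreal_pi : (NNReal.pi : ℝ≥0∞) = ENNReal.ofReal Real.pi := by
  rw [ENNReal.ofReal, Real.toNNReal_of_nonneg Real.pi_pos.le]
  rfl

instance : IsProbabilityMeasure dA := by
  constructor
  have h : volume (ball (0 : ℂ) 1) = ENNReal.ofReal Real.pi := by
    rw [Complex.volume_ball, coe_nnreal_pi]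
    simp
  simp only [dA, Measure.smul_apply, Measure.restrict_apply_univ, smul_eq_mul, h]
  exact ENNReal.inv_mul_cancel ofReal_pi_ne_zero ENNReal.ofReal_ne_top

lemma ae_dA : ae dA = ae (volume.restrict (ball (0 : ℂ) 1)) :=
  Measure.ae_ennreal_smul_measure_eq (by simp) _

lemma aestronglyMeasurable_of_diff {g : ℂ → ℂ} (hg : DifferentiableOn ℂ g (ball 0 1)) :
    AEStronglyMeasurable g dA :=
  (hg.continuousOn.aestronglyMeasurable isOpen_ball.measurableSet).smul_measure _

lemma eqOn_of_ae_eq_dA {g h : ℂ → ℂ} (hg : DifferentiableOn ℂ g (ball 0 1))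
    (hh : DifferentiableOn ℂ h (ball 0 1)) (e : g =ᵐ[dA] h) : EqOn g h (ball 0 1) := by
  rw [Filter.EventuallyEq, ae_dA] at e
  exact Measure.eqOn_open_of_ae_eq e isOpen_ball hg.continuousOn hh.continuousOn

lemma circle_mean {f : ℂ → ℂ} (hf : DifferentiableOn ℂ f (ball 0 1)) {z : ℂ} {r : ℝ}
    (hr : 0 < r) (hz : closedBall z r ⊆ ball 0 1) :
    ∫⁻ _ in Ioo (-Real.pi) Real.pi, ‖f z‖ₑ ≤
      ∫⁻ θ in Ioo (-Real.pi) Real.pi, ‖f (z + r * (Real.cos θ + Real.sin θ * I))‖ₑ := by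
  have h1 : Real.circleAverage f z r = f z := by
    apply DiffContOnCl.circleAverage
    rw [abs_of_pos hr]
    apply DifferentiableOn.diffContOnCl
    rw [closure_ball _ hr.ne']
    exact hf.mono hz
  have h2 : (∫ θ in (-Real.pi)..Real.pi, f (circleMap z r θ)) = (2 * Real.pi) • f z := by
    rw [← h1, Real.circleAverage_def, smul_inv_smul₀ (by positivity)]
    have := (periodic_circleMap z r).comp f
    have h3 := this.intervalIntegral_add_eq (-Real.pi) 0
    simp only [Function.comp] at h3
    convert h3 using 2 <;> ring
  have h4 : ∀ θ : ℝ, z + r * (Real.cos θ + Real.sin θ * I) = circleMap z r θ := by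
    intro θ
    simp [circleMap, Complex.exp_mul_I]
  simp only [h4]
  rw [intervalIntegral.integral_of_le (by linarith [Real.pi_pos]),
    integral_Ioc_eq_integral_Ioo] at h2
  calc _ = ‖(2 * Real.pi) • f z‖ₑ := by
        rw [enorm_smul, lintegral_const, Measure.restrict_apply_univ, Real.volume_Ioo, mul_comm]
        congr 1
        rw [Real.enorm_eq_ofReal (by positivity)]
        congr 1; ring
    _ ≤ _ := by rw [← h2]; exact enorm_integral_le_lintegral_enorm _

lemma ball_mean {f : ℂ → ℂ} (hf : DifferentiableOn ℂ f (ball 0 1)) {z : ℂ} {r : ℝ}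
    (hz : ball z r ⊆ ball 0 1) :
    ‖f z‖ₑ * volume (ball (0 : ℂ) r) ≤ ∫⁻ w in ball 0 1, ‖f w‖ₑ := by
  classical
  set G : ℂ → ℝ≥0∞ := (ball (0 : ℂ) r).indicator fun w => ‖f (z + w)‖ₑ with hG
  have hGm : Measurable G := by
    have hc : ContinuousOn (fun w => ‖f (z + w)‖ₑ) (ball (0 : ℂ) r) := by
      apply ContinuousOn.enorm
      apply hf.continuousOn.comp (by fun_prop)
      intro w hw
      apply hz
      simpa using hw
    have := hc.measurable_piecewise (g := 0) continuousOn_const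
      isOpen_ball.measurableSet
    rwa [Set.piecewise_eq_indicator] at this
  have h1 : ∫⁻ w, G w ≤ ∫⁻ w in ball 0 1, ‖f w‖ₑ := by
    rw [← lintegral_sub_right_eq_self G z, ← lintegral_indicator isOpen_ball.measurableSet]
    apply lintegral_mono
    intro w
    by_cases hw : w - z ∈ ball (0 : ℂ) r
    · have : w ∈ ball (0 : ℂ) 1 := hz (by simpa [dist_eq_norm] using hw)
      simp only [hG, indicator_of_mem hw, indicator_of_mem this]
      simp
    · simp only [hG, indicator_of_notMem hw]
      exact zero_le
  refine le_trans ?_ h1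
  rw [← lintegral_indicator_const isOpen_ball.measurableSet,
    ← Complex.lintegral_comp_polarCoord_symm, ← Complex.lintegral_comp_polarCoord_symm,
    polarCoord_target, Measure.volume_eq_prod, ← Measure.prod_restrict]
  have hpm : Measurable fun p : ℝ × ℝ => Complex.polarCoord.symm p := by
    simp only [Complex.polarCoord_symm_apply]; fun_prop
  rw [lintegral_prod, lintegral_prod]
  rotate_left
  · exact (Measurable.smul measurable_fst.ennreal_ofReal (hGm.comp hpm)).aemeasurable
  · exact (Measurable.smul measurable_fst.ennreal_ofReal ((measurable_const.indicator
      isOpen_ball.measurableSet).comp hpm)).aemeasurable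
  refine setLIntegral_mono' measurableSet_Ioi fun ρ hρ => ?_
  have hρ : 0 < ρ := hρ
  have hm : Measurable fun θ : ℝ => G (Complex.polarCoord.symm (ρ, θ)) :=
    hGm.comp (hpm.comp (by fun_prop))
  have hm' : Measurable fun θ : ℝ => (ball (0 : ℂ) r).indicator (fun _ => ‖f z‖ₑ)
      (Complex.polarCoord.symm (ρ, θ)) :=
    (measurable_const.indicator isOpen_ball.measurableSet).comp (hpm.comp (by fun_prop))
  simp only [smul_eq_mul]
  rw [lintegral_const_mul _ hm, lintegral_const_mul _ hm']
  refine mul_le_mul_right ?_ _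
  by_cases hρr : ρ < r
  · have hmem : ∀ θ : ℝ, Complex.polarCoord.symm (ρ, θ) ∈ ball (0 : ℂ) r := by
      intro θ
      rw [mem_ball_zero_iff, Complex.norm_polarCoord_symm, abs_of_pos hρ]
      exact hρr
    simp only [hG, indicator_of_mem (hmem _)]
    simp only [Complex.polarCoord_symm_apply]
    exact circle_mean hf hρ ((closedBall_subset_ball hρr).trans hz)
  · have hmem : ∀ θ : ℝ, Complex.polarCoord.symm (ρ, θ) ∉ ball (0 : ℂ) r := by
      intro θ
      rw [mem_ball_zero_iff, Complex.norm_polarCoord_symm, abs_of_pos hρ]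
      exact hρr
    simp only [hG, indicator_of_notMem (hmem _)]
    exact le_rfl

/-- Point evaluations are bounded in the `L²` norm on holomorphic functions. -/
lemma norm_le_eLpNorm {f : ℂ → ℂ} (hf : DifferentiableOn ℂ f (ball 0 1)) {z : ℂ} {r : ℝ}
    (hr : 0 < r) (hz : ball z r ⊆ ball 0 1) (h2 : MemLp f 2 dA) :
    ‖f z‖ ≤ (r ^ 2)⁻¹ * (eLpNorm f 2 dA).toReal := by
  have h := ball_mean hf hz
  have h1 : eLpNorm f 1 dA ≤ eLpNorm f 2 dA :=
    eLpNorm_le_eLpNorm_of_exponent_le (by norm_num) h2.1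
  rw [eLpNorm_one_eq_lintegral_enorm, dA, lintegral_smul_measure, ← dA] at h1
  rw [Complex.volume_ball] at h
  rw [coe_nnreal_pi] at h
  have h3 : ‖f z‖ₑ * ENNReal.ofReal r ^ 2 ≤ eLpNorm f 2 dA := by
    refine le_trans ?_ h1
    rw [smul_eq_mul, mul_comm _⁻¹, ← div_eq_mul_inv,
      ENNReal.le_div_iff_mul_le (.inl ofReal_pi_ne_zero) (.inl ENNReal.ofReal_ne_top), mul_assoc]
    exact h
  have h4 := ENNReal.toReal_mono h2.2.ne h3
  rw [ENNReal.toReal_mul, ENNReal.toReal_pow, ENNReal.toReal_ofReal hr.le, toReal_enorm] at h4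
  rw [inv_mul_eq_div, le_div_iff₀ (by positivity)]
  exact h4

/-- The Bergman space `L²ₐ`: the (classes of) functions in `L²(D, dA)` that are analytic on `D`. -/
noncomputable def L2a : Submodule ℂ (Lp ℂ 2 dA) where
  carrier := {f | ∃ g : ℂ → ℂ, DifferentiableOn ℂ g (ball 0 1) ∧ f =ᵐ[dA] g}
  add_mem' := by
    rintro a b ⟨g, hg, eg⟩ ⟨h, hh, eh⟩
    exact ⟨g + h, hg.add hh, (Lp.coeFn_add a b).trans (eg.add eh)⟩
  zero_mem' := ⟨0, differentiableOn_const 0, Lp.coeFn_zero ..⟩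
  smul_mem' := by
    rintro c a ⟨g, hg, eg⟩
    exact ⟨c • g, hg.const_smul c, (Lp.coeFn_smul c a).trans (eg.const_smul c)⟩

/-- The analytic function on `D` that represents an element of the Bergman space
(it is unique on `D`; its values off `D` carry no meaning and are never used). -/
noncomputable def toFun (f : L2a) : ℂ → ℂ := Classical.choose f.2

lemma toFun_diff (f : L2a) : DifferentiableOn ℂ (toFun f) (ball 0 1) :=
  (Classical.choose_spec f.2).1

lemma toFun_ae (f : L2a) : (f : Lp ℂ 2 dA) =ᵐ[dA] toFun f := (Classical.choose_spec f.2).2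

lemma toFun_eqOn (f : L2a) {g : ℂ → ℂ} (hg : DifferentiableOn ℂ g (ball 0 1))
    (e : (f : Lp ℂ 2 dA) =ᵐ[dA] g) : EqOn (toFun f) g (ball 0 1) :=
  eqOn_of_ae_eq_dA (toFun_diff f) hg ((toFun_ae f).symm.trans e)

lemma toFun_add (f g : L2a) : EqOn (toFun (f + g)) (toFun f + toFun g) (ball 0 1) :=
  toFun_eqOn _ ((toFun_diff f).add (toFun_diff g))
    ((Lp.coeFn_add (f : Lp ℂ 2 dA) g).trans ((toFun_ae f).add (toFun_ae g)))

lemma toFun_smul (c : ℂ) (f : L2a) : EqOn (toFun (c • f)) (c • toFun f) (ball 0 1) :=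
  toFun_eqOn _ ((toFun_diff f).const_smul c)
    ((Lp.coeFn_smul c (f : Lp ℂ 2 dA)).trans ((toFun_ae f).const_smul c))

lemma memLp_toFun (f : L2a) : MemLp (toFun f) 2 dA := (Lp.memLp _).ae_eq (toFun_ae f)

lemma eLpNorm_toFun (f : L2a) : (eLpNorm (toFun f) 2 dA).toReal = ‖f‖ := by
  rw [← eLpNorm_congr_ae (toFun_ae f), Submodule.coe_norm, Lp.norm_def]

lemma norm_toFun_le (f : L2a) {z : ℂ} {r : ℝ} (hr : 0 < r) (hz : ball z r ⊆ ball 0 1) :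
    ‖toFun f z‖ ≤ (r ^ 2)⁻¹ * ‖f‖ := by
  rw [← eLpNorm_toFun]
  exact norm_le_eLpNorm (toFun_diff f) hr hz (memLp_toFun f)

lemma ball_sub {z : ℂ} : ball z (1 - ‖z‖) ⊆ ball 0 1 :=
  ball_subset_ball' (by simp)

/-- Point evaluation `f ↦ f(z)` at `z ∈ D`, as a bounded linear functional on `L²ₐ`. -/
noncomputable def evalAt (z : 𝔻) : StrongDual ℂ L2a :=
  LinearMap.mkContinuous
    { toFun := fun f => toFun f z
      map_add' := fun f g => toFun_add f g (by simpa using z.norm_lt_one)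
      map_smul' := fun c f => toFun_smul c f (by simpa using z.norm_lt_one) }
    (((1 - ‖(z : ℂ)‖) ^ 2)⁻¹)
    (fun f => norm_toFun_le f (by linarith [z.norm_lt_one]) ball_sub)

lemma sub_toFun (f g : L2a) : EqOn (toFun (f - g)) (toFun f - toFun g) (ball 0 1) :=
  toFun_eqOn _ ((toFun_diff f).sub (toFun_diff g))
    ((Lp.coeFn_sub (f : Lp ℂ 2 dA) g).trans ((toFun_ae f).sub (toFun_ae g)))

lemma isClosed_L2a : IsClosed (L2a : Set (Lp ℂ 2 dA)) := by
  apply IsSeqClosed.isClosed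
  intro x f hx hf
  let y : ℕ → L2a := fun n => ⟨x n, hx n⟩
  have hy : CauchySeq y := by
    have := hf.cauchySeq
    rw [Metric.cauchySeq_iff] at this ⊢
    exact this
  have hloc : ∀ z ∈ ball (0 : ℂ) 1, ∃ t ∈ 𝓝 z, t ⊆ ball 0 1 ∧
      UniformCauchySeqOn (fun n => toFun (y n)) atTop t := by
    intro z hz
    set r := (1 - ‖z‖) / 2 with hr
    have hr0 : 0 < r := by
      rw [mem_ball_zero_iff] at hz; rw [hr]; linarith
    have hb : ∀ w ∈ ball z r, ball w r ⊆ ball 0 1 := by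
      intro w hw
      apply ball_subset_ball'
      rw [mem_ball, dist_eq_norm] at hw
      rw [dist_zero_right]
      have := norm_add_le (w - z) z
      simp only [sub_add_cancel] at this
      linarith
    have ht : ball z r ⊆ ball 0 1 := hb z (mem_ball_self hr0)
    refine ⟨ball z r, ball_mem_nhds z hr0, ht, ?_⟩
    rw [Metric.uniformCauchySeqOn_iff]
    intro ε hε
    obtain ⟨N, hN⟩ := Metric.cauchySeq_iff.1 hy (r ^ 2 * ε) (by positivity)
    refine ⟨N, fun m hm n hn w hw => ?_⟩
    rw [dist_eq_norm]
    have e := sub_toFun (y m) (y n) (ht hw)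
    simp only [Pi.sub_apply] at e
    rw [← e]
    refine (norm_toFun_le _ hr0 (hb w hw)).trans_lt ?_
    rw [inv_mul_lt_iff₀ (by positivity), ← dist_eq_norm]
    exact hN m hm n hn
  have hpt : ∀ z ∈ ball (0 : ℂ) 1, ∃ l, Tendsto (fun n => toFun (y n) z) atTop (𝓝 l) := by
    intro z hz
    obtain ⟨t, ht, -, hu⟩ := hloc z hz
    exact cauchySeq_tendsto_of_complete (hu.cauchySeq (mem_of_mem_nhds ht))
  choose! g hg using hpt
  have hlu : TendstoLocallyUniformlyOn (fun n => toFun (y n)) g atTop (ball 0 1) := by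
    refine tendstoLocallyUniformlyOn_of_forall_exists_nhds fun z hz => ?_
    obtain ⟨t, ht, hts, hu⟩ := hloc z hz
    exact ⟨t, mem_nhdsWithin_of_mem_nhds ht,
      hu.tendstoUniformlyOn_of_tendsto fun w hw => hg w (hts hw)⟩
  refine ⟨g, hlu.differentiableOn (Eventually.of_forall fun n => toFun_diff _) isOpen_ball, ?_⟩
  obtain ⟨ns, hns, hae⟩ := (tendstoInMeasure_of_tendsto_Lp hf).exists_seq_tendsto_ae
  have hall : ∀ᵐ w ∂dA, ∀ n, x n w = toFun (y n) w := ae_all_iff.2 fun n => toFun_ae (y n)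
  have hD : ∀ᵐ w ∂dA, w ∈ ball (0 : ℂ) 1 := by
    rw [ae_dA]; exact ae_restrict_mem isOpen_ball.measurableSet
  filter_upwards [hae, hall, hD] with w h1 h2 h3
  refine tendsto_nhds_unique h1 ?_
  simp only [h2]
  exact (hg w h3).comp hns.tendsto_atTop

instance : CompleteSpace L2a := isClosed_L2a.completeSpace_coe

/-- The Bergman reproducing kernel `K_z`: the element of `L²ₐ` that represents evaluation at `z`
(see `inner_K`). -/
noncomputable def K (z : 𝔻) : L2a := (InnerProductSpace.toDual ℂ L2a).symm (evalAt z)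

lemma inner_K (z : 𝔻) (f : L2a) : inner ℂ (K z) f = toFun f z :=
  InnerProductSpace.toDual_symm_apply

/-- The normalized reproducing kernel `k_z = K_z / ‖K_z‖₂`. -/
noncomputable def k (z : 𝔻) : L2a := (‖K z‖ : ℂ)⁻¹ • K z

/-- The Berezin transform `⟨S k_z, k_z⟩` (Mathlib's inner product is linear in the second slot). -/
noncomputable def berezin (S : L2a →L[ℂ] L2a) (z : 𝔻) : ℂ := inner ℂ (k z) (S (k z))

/-- The Toeplitz operator `T_u f = P(u f)` with symbol `u ∈ L^∞(D, dA)`, where `P` is the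
orthogonal projection of `L²(D, dA)` onto `L²ₐ`. -/
noncomputable def toeplitz (u : Lp ℂ ∞ dA) : L2a →L[ℂ] L2a :=
  L2a.orthogonalProjectionOnto ∘L
    ((ContinuousLinearMap.mul ℂ ℂ).holderL dA ∞ 2 2 u) ∘L L2a.subtypeL

/-- The disk automorphism `φ_z(w) = (z - w) / (1 - z̄ w)`. -/
noncomputable def phi (z : 𝔻) (w : ℂ) : ℂ := (z - w) / (1 - conj (z : ℂ) * w)

lemma den_ne (z : 𝔻) {w : ℂ} (hw : w ∈ ball (0 : ℂ) 1) : 1 - conj (z : ℂ) * w ≠ 0 := by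
  intro h
  have h1 : ‖conj (z : ℂ) * w‖ = 1 := by rw [← sub_eq_zero.1 h]; simp
  rw [norm_mul, RCLike.norm_conj] at h1
  have := z.norm_lt_one
  rw [mem_ball_zero_iff] at hw
  nlinarith [norm_nonneg (z : ℂ), norm_nonneg w]

lemma phi_mem (z : 𝔻) {w : ℂ} (hw : w ∈ ball (0 : ℂ) 1) : phi z w ∈ ball (0 : ℂ) 1 := by
  have hd := den_ne z hw
  rw [mem_ball_zero_iff, phi, norm_div, div_lt_one (norm_pos_iff.2 hd)]
  have hz := z.norm_lt_one
  rw [mem_ball_zero_iff] at hw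
  apply lt_of_pow_lt_pow_left₀ 2 (norm_nonneg _)
  have key : ‖1 - conj (z : ℂ) * w‖ ^ 2 - ‖(z : ℂ) - w‖ ^ 2
      = (1 - ‖(z : ℂ)‖ ^ 2) * (1 - ‖w‖ ^ 2) := by
    simp only [← Complex.normSq_eq_norm_sq, Complex.normSq_apply, Complex.sub_re, Complex.sub_im,
      Complex.mul_re, Complex.mul_im, Complex.conj_re, Complex.conj_im, Complex.one_re,
      Complex.one_im]
    ring
  have : 0 < (1 - ‖(z : ℂ)‖ ^ 2) * (1 - ‖w‖ ^ 2) :=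
    mul_pos (by nlinarith [norm_nonneg (z : ℂ)]) (by nlinarith [norm_nonneg w])
  linarith

lemma phi_phi (z : 𝔻) {w : ℂ} (hw : w ∈ ball (0 : ℂ) 1) : phi z (phi z w) = w := by
  have h1 := den_ne z hw
  have h2 := den_ne z (phi_mem z hw)
  have e : phi z w * (1 - conj (z : ℂ) * w) = z - w := div_mul_cancel₀ _ h1
  rw [phi, div_eq_iff h2]
  linear_combination -e

lemma phi_diff (z : 𝔻) : DifferentiableOn ℂ (phi z) (ball 0 1) := by
  unfold phi
  exact DifferentiableOn.div (by fun_prop) (by fun_prop) fun w hw => den_ne z hw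

lemma phi_injOn (z : 𝔻) : InjOn (phi z) (ball 0 1) := fun a ha b hb h => by
  rw [← phi_phi z ha, h, phi_phi z hb]

lemma phi_image (z : 𝔻) : phi z '' ball 0 1 = ball 0 1 := by
  ext w
  constructor
  · rintro ⟨v, hv, rfl⟩
    exact phi_mem z hv
  · exact fun hw => ⟨phi z w, phi_mem z hw, phi_phi z hw⟩

/-- The function `(f ∘ φ_z) φ_z'`. -/
noncomputable def pullback (z : 𝔻) (f : ℂ → ℂ) (w : ℂ) : ℂ := f (phi z w) * deriv (phi z) w

lemma pullback_diff (z : 𝔻) {f : ℂ → ℂ} (hf : DifferentiableOn ℂ f (ball 0 1)) :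
    DifferentiableOn ℂ (pullback z f) (ball 0 1) :=
  (hf.comp (phi_diff z) fun _ hw => phi_mem z hw).mul ((phi_diff z).deriv isOpen_ball)

lemma eLpNorm_pullback (z : 𝔻) (f : ℂ → ℂ) :
    eLpNorm (pullback z f) 2 dA = eLpNorm f 2 dA := by
  have hd : ∀ w ∈ ball (0 : ℂ) 1, HasFDerivWithinAt (phi z)
      ((ContinuousLinearMap.toSpanSingleton ℂ (deriv (phi z) w)).restrictScalars ℝ)
      (ball 0 1) w := fun w hw =>
    (((phi_diff z).differentiableAt (isOpen_ball.mem_nhds hw)).hasDerivAt.hasFDerivAt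
      |>.restrictScalars ℝ).hasFDerivWithinAt
  have h := lintegral_image_eq_lintegral_abs_det_fderiv_mul volume isOpen_ball.measurableSet hd
    (phi_injOn z) (fun w => ‖f w‖ₑ ^ (2 : ℝ))
  rw [phi_image] at h
  simp only [eLpNorm_eq_lintegral_rpow_enorm_toReal (two_ne_zero) ENNReal.ofNat_ne_top,
    ENNReal.toReal_ofNat]
  rw [dA, lintegral_smul_measure, lintegral_smul_measure, h]
  congr 3
  funext w
  rw [pullback, enorm_mul, ENNReal.mul_rpow_of_nonneg _ _ (by norm_num), mul_comm]
  congr 1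
  have : ((ContinuousLinearMap.toSpanSingleton ℂ (deriv (phi z) w)).restrictScalars ℝ).det
      = ‖deriv (phi z) w‖ ^ 2 := by
    simp [ContinuousLinearMap.det, LinearMap.det_restrictScalars, Algebra.norm_complex_eq,
      Complex.normSq_eq_norm_sq]
  rw [this, abs_of_nonneg (by positivity), ← ofReal_norm,
    ENNReal.ofReal_rpow_of_nonneg (norm_nonneg _) (by norm_num)]
  norm_num

lemma memLp_pullback (z : 𝔻) (f : L2a) : MemLp (pullback z (toFun f)) 2 dA :=
  ⟨aestronglyMeasurable_of_diff (pullback_diff z (toFun_diff f)), by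
    rw [eLpNorm_pullback]; exact (memLp_toFun f).2⟩

lemma pullback_ae {z : 𝔻} {f g : ℂ → ℂ} (h : EqOn f g (ball 0 1)) :
    pullback z f =ᵐ[dA] pullback z g := by
  rw [Filter.EventuallyEq, ae_dA]
  filter_upwards [ae_restrict_mem isOpen_ball.measurableSet] with w hw
  rw [pullback, pullback, h (phi_mem z hw)]

/-- The operator `U_z f = (f ∘ φ_z) φ_z'` on the Bergman space. -/
noncomputable def U (z : 𝔻) : L2a →ₗᵢ[ℂ] L2a where
  toFun f := ⟨(memLp_pullback z f).toLp, pullback z (toFun f), pullback_diff z (toFun_diff f),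
    MemLp.coeFn_toLp _⟩
  map_add' f g := by
    apply Subtype.ext
    refine ((MemLp.toLp_congr (memLp_pullback z (f + g))
      ((memLp_pullback z f).add (memLp_pullback z g)) ?_)).trans
      (MemLp.toLp_add (memLp_pullback z f) (memLp_pullback z g))
    refine (pullback_ae (toFun_add f g)).trans (Eventually.of_forall fun w => ?_)
    simp only [pullback, Pi.add_apply]
    ring
  map_smul' c f := by
    apply Subtype.ext
    refine ((MemLp.toLp_congr (memLp_pullback z (c • f))
      ((memLp_pullback z f).const_smul c) ?_)).trans
      (MemLp.toLp_const_smul c (memLp_pullback z f))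
    refine (pullback_ae (toFun_smul c f)).trans (Eventually.of_forall fun w => ?_)
    simp only [pullback, Pi.smul_apply, smul_eq_mul]
    ring
  norm_map' f := by
    change ‖(memLp_pullback z f).toLp‖ = _
    rw [Lp.norm_toLp, eLpNorm_pullback, eLpNorm_toFun]

/-- The conjugated operator `S_z = U_z S U_z`. -/
noncomputable def conjBy (S : L2a →L[ℂ] L2a) (z : 𝔻) : L2a →L[ℂ] L2a :=
  (U z).toContinuousLinearMap ∘L S ∘L (U z).toContinuousLinearMap

/-- The constant function `1` as an element of the Bergman space. -/
noncomputable def one : L2a :=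
  ⟨(memLp_const (1 : ℂ)).toLp, fun _ => 1, differentiableOn_const 1, MemLp.coeFn_toLp _⟩

/-- The filter `z → ∂D` on the disk: `|z| → 1`. -/
noncomputable def toBoundary : Filter 𝔻 := comap (fun z : 𝔻 => ‖(z : ℂ)‖) (𝓝 1)

end Bergman

namespace Bergman

/-! The real content is that a Berezin transform vanishing at the boundary forces compactness. The
chain is (a) → (b) → (c) → (d) → (f) → (a), and (f) → (e) → (b) closes it. The cheap links: `k z`
tends weakly to `0`, and compact operators send bounded weakly null families to norm null ones; (b)
gives (c) by Cauchy–Schwarz; (e) is the case `p = 2` of (f); and `‖S_z 1‖ = ‖S k_z‖` because `k z =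
-U z one`.

(c) → (d). Up to the factor `‖K_w‖²`, `⟨K_w, S_z K_w⟩` is the Berezin transform of `S` at `φ_z(w)`,
and `φ_z(w) → ∂D` as `z → ∂D`. Hence every weak operator limit `T` of the bounded family `S_z` has
zero Berezin transform. Polarization of a function holomorphic in two variables then gives `T 1 = 0`
(`inner_K_apply_one_eq_zero`).

(d) → (f). Toeplitz products are used only here and through their adjoints in the last link. Both
they and their adjoints satisfy `GrowthBounded`, so `|S_z 1(w)| ≤ C (1 - |w|²)^(-ε)` with `C`
independent of `z`, for each small `ε > 0`. Weak convergence gives pointwise convergence, and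
dominated convergence does the rest.

(f) → (a). `S` is an integral operator with kernel `(S K_z)(w)`. Its part over `|z| ≤ r` is compact.
The part over `|z| > r` is controlled by the Schur test with weight `(1 - |w|²)^(-1/2)`: one Schur
constant is at most a multiple of the supremum of `‖S_z 1‖_6` over `|z| > r`, hence small, and the
other is bounded by the growth estimate for the adjoint. -/

lemma coe_mem_ball (z : 𝔻) : (z : ℂ) ∈ ball (0 : ℂ) 1 := by simpa using z.norm_lt_one

lemma ae_mem_ball : ∀ᵐ w ∂dA, w ∈ ball (0 : ℂ) 1 := by
  rw [ae_dA]; exact ae_restrict_mem isOpen_ball.measurableSet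

lemma one_sub_sq_pos {w : ℂ} (hw : w ∈ ball (0 : ℂ) 1) : 0 < 1 - ‖w‖ ^ 2 := by
  rw [mem_ball_zero_iff] at hw
  nlinarith [norm_nonneg w]

lemma L2a_ext {f g : L2a} (h : EqOn (toFun f) (toFun g) (ball 0 1)) : f = g := by
  apply Subtype.ext
  apply Lp.ext
  refine (toFun_ae f).trans (EventuallyEq.trans ?_ (toFun_ae g).symm)
  filter_upwards [ae_mem_ball] with w hw using h hw

lemma L2a.inner_smul_left (f g : L2a) (c : ℂ) : inner ℂ (c • f) g = conj c * inner ℂ f g :=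
  _root_.inner_smul_left f g c

lemma L2a.inner_smul_right (f g : L2a) (c : ℂ) : inner ℂ f (c • g) = c * inner ℂ f g :=
  _root_.inner_smul_right f g c

lemma L2a.inner_self (f : L2a) : inner ℂ f f = (‖f‖ : ℂ) ^ 2 :=
  inner_self_eq_norm_sq_to_K f

lemma toFun_U (z : 𝔻) (f : L2a) : EqOn (toFun (U z f)) (pullback z (toFun f)) (ball 0 1) :=
  toFun_eqOn _ (pullback_diff z (toFun_diff f)) (MemLp.coeFn_toLp (memLp_pullback z f))

lemma toFun_one : EqOn (toFun one) (fun _ => 1) (ball 0 1) :=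
  toFun_eqOn _ (differentiableOn_const 1) (MemLp.coeFn_toLp (memLp_const 1))

lemma inner_eq_integral (f g : L2a) : inner ℂ f g = ∫ w, conj (toFun f w) * toFun g w ∂dA := by
  rw [Submodule.coe_inner, L2.inner_def]
  apply integral_congr_ae
  filter_upwards [toFun_ae f, toFun_ae g] with w h1 h2
  rw [h1, h2, RCLike.inner_apply, mul_comm]

/-! ### Disk automorphisms, the unitaries `U z`, and the explicit kernel. -/

lemma hasDerivAt_phi (z : 𝔻) {w : ℂ} (hw : w ∈ ball (0 : ℂ) 1) :
    HasDerivAt (phi z) (-(1 - ‖(z : ℂ)‖ ^ 2 : ℝ) / (1 - conj (z : ℂ) * w) ^ 2) w := by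
  have h := den_ne z hw
  have h1 : HasDerivAt (fun w : ℂ => (z : ℂ) - w) (-1) w := by
    simpa using (hasDerivAt_id w).const_sub (z : ℂ)
  have h2 : HasDerivAt (fun w : ℂ => 1 - conj (z : ℂ) * w) (-conj (z : ℂ)) w := by
    simpa using ((hasDerivAt_id w).const_mul (conj (z : ℂ))).const_sub 1
  have h3 := h1.div h2 h
  refine h3.congr_deriv ?_
  congr 1
  have : ((‖(z : ℂ)‖ ^ 2 : ℝ) : ℂ) = conj (z : ℂ) * z := by
    rw [mul_comm, Complex.mul_conj, Complex.normSq_eq_norm_sq]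
  push_cast at this ⊢
  rw [this]
  ring

lemma deriv_phi (z : 𝔻) {w : ℂ} (hw : w ∈ ball (0 : ℂ) 1) :
    deriv (phi z) w = -(1 - ‖(z : ℂ)‖ ^ 2 : ℝ) / (1 - conj (z : ℂ) * w) ^ 2 :=
  (hasDerivAt_phi z hw).deriv

lemma norm_deriv_phi (z : 𝔻) {w : ℂ} (hw : w ∈ ball (0 : ℂ) 1) :
    ‖deriv (phi z) w‖ = (1 - ‖(z : ℂ)‖ ^ 2) / ‖1 - conj (z : ℂ) * w‖ ^ 2 := by
  rw [deriv_phi z hw, norm_div, norm_neg, norm_pow, Complex.norm_real, Real.norm_eq_abs,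
    abs_of_pos (one_sub_sq_pos (coe_mem_ball z))]

lemma deriv_phi_mul_deriv_phi (z : 𝔻) {w : ℂ} (hw : w ∈ ball (0 : ℂ) 1) :
    deriv (phi z) (phi z w) * deriv (phi z) w = 1 := by
  have h1 := (hasDerivAt_phi z (phi_mem z hw)).comp w (hasDerivAt_phi z hw)
  rw [deriv_phi z hw, deriv_phi z (phi_mem z hw)]
  refine h1.unique ((hasDerivAt_id w).congr_of_eventuallyEq ?_)
  filter_upwards [isOpen_ball.mem_nhds hw] with v hv using phi_phi z hv

lemma one_sub_norm_phi_sq (z : 𝔻) {w : ℂ} (hw : w ∈ ball (0 : ℂ) 1) :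
    1 - ‖phi z w‖ ^ 2 =
      (1 - ‖(z : ℂ)‖ ^ 2) * (1 - ‖w‖ ^ 2) / ‖1 - conj (z : ℂ) * w‖ ^ 2 := by
  have hd : ‖1 - conj (z : ℂ) * w‖ ≠ 0 := norm_ne_zero_iff.2 (den_ne z hw)
  have key : ‖1 - conj (z : ℂ) * w‖ ^ 2 - ‖(z : ℂ) - w‖ ^ 2
      = (1 - ‖(z : ℂ)‖ ^ 2) * (1 - ‖w‖ ^ 2) := by
    simp only [← Complex.normSq_eq_norm_sq, Complex.normSq_apply, Complex.sub_re, Complex.sub_im,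
      Complex.mul_re, Complex.mul_im, Complex.conj_re, Complex.conj_im, Complex.one_re,
      Complex.one_im]
    ring
  rw [← key, phi, norm_div, div_pow, sub_div, div_self (pow_ne_zero 2 hd)]

/-- Change of variables under a disk automorphism. -/
lemma lintegral_comp_phi (z : 𝔻) (g : ℂ → ℝ≥0∞) :
    ∫⁻ w, ‖deriv (phi z) w‖ₑ ^ 2 * g (phi z w) ∂dA = ∫⁻ w, g w ∂dA := by
  have hd : ∀ w ∈ ball (0 : ℂ) 1, HasFDerivWithinAt (phi z)
      ((ContinuousLinearMap.toSpanSingleton ℂ (deriv (phi z) w)).restrictScalars ℝ)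
      (ball 0 1) w := fun w hw =>
    (((phi_diff z).differentiableAt (isOpen_ball.mem_nhds hw)).hasDerivAt.hasFDerivAt
      |>.restrictScalars ℝ).hasFDerivWithinAt
  have h := lintegral_image_eq_lintegral_abs_det_fderiv_mul volume isOpen_ball.measurableSet hd
    (phi_injOn z) g
  rw [phi_image] at h
  rw [dA, lintegral_smul_measure, lintegral_smul_measure, h]
  congr 2
  funext w
  congr 1
  have : ((ContinuousLinearMap.toSpanSingleton ℂ (deriv (phi z) w)).restrictScalars ℝ).det
      = ‖deriv (phi z) w‖ ^ 2 := by
    simp [ContinuousLinearMap.det, LinearMap.det_restrictScalars, Algebra.norm_complex_eq,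
      Complex.normSq_eq_norm_sq]
  rw [this, abs_of_nonneg (by positivity), ← ofReal_norm, ENNReal.ofReal_pow (norm_nonneg _)]

lemma U_U (z : 𝔻) (f : L2a) : U z (U z f) = f := by
  apply L2a_ext
  intro w hw
  rw [toFun_U z _ hw, pullback, toFun_U z _ (phi_mem z hw), pullback, phi_phi z hw, mul_assoc,
    deriv_phi_mul_deriv_phi z hw, mul_one]

lemma inner_U_left (z : 𝔻) (f g : L2a) : inner ℂ (U z f) g = inner ℂ f (U z g) := by
  rw [← (U z).inner_map_map f, U_U]

lemma measurePreserving_mul {ζ : ℂ} (hζ : ‖ζ‖ = 1) : MeasurePreserving (ζ * ·) dA dA := by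
  have h1 : MeasurePreserving (ζ * ·) (volume : Measure ℂ) volume := by
    have := (rotation ⟨ζ, by simpa [Submonoid.unitSphere] using hζ⟩).measurePreserving
    exact this
  have h2 := h1.restrict_preimage (isOpen_ball (x := (0 : ℂ)) (ε := 1)).measurableSet
  have h3 : (ζ * ·) ⁻¹' ball (0 : ℂ) 1 = ball 0 1 := by
    ext w; simp [hζ]
  rw [h3] at h2
  exact h2.smul_measure _

/-- `dA` is rotation invariant, so the integral equals its average over all rotations. Fubini turns
this into circle means, each of which is the value at the centre. -/
lemma integral_toFun (f : L2a) : ∫ w, toFun f w ∂dA = toFun f 0 := by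
  have hf : Integrable (toFun f) dA := (memLp_toFun f).integrable (by norm_num)
  let ν : Measure ℝ := volume.restrict (Ioc 0 (2 * Real.pi))
  have hsk : MeasurePreserving (fun p : ℝ × ℂ => (p.1, circleMap 0 1 p.1 * p.2))
      (ν.prod dA) (ν.prod dA) := by
    refine MeasurePreserving.skew_product (g := fun θ w => circleMap 0 1 θ * w)
      (MeasurePreserving.id ν) (by unfold Function.uncurry; fun_prop) ?_
    exact Eventually.of_forall fun θ => (measurePreserving_mul (by simp)).map_eq
  have hint : Integrable (fun p : ℝ × ℂ => toFun f (circleMap 0 1 p.1 * p.2)) (ν.prod dA) := by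
    have := hf.comp_snd ν
    exact hsk.integrable_comp_of_integrable this
  have h1 : ∀ θ : ℝ, ∫ w, toFun f (circleMap 0 1 θ * w) ∂dA = ∫ w, toFun f w ∂dA := by
    intro θ
    have hmp := measurePreserving_mul (ζ := circleMap 0 1 θ) (by simp)
    have := integral_map (f := toFun f) hmp.measurable.aemeasurable (by rw [hmp.map_eq]; exact hf.1)
    rw [hmp.map_eq] at this
    exact this.symm
  have h2 : ∀ w ∈ ball (0 : ℂ) 1, ∫ θ, toFun f (circleMap 0 1 θ * w) ∂ν =
      (2 * Real.pi) • toFun f 0 := by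
    intro w hw
    have hd : DifferentiableOn ℂ (fun ζ => toFun f (ζ * w)) (closedBall 0 1) := by
      refine (toFun_diff f).comp (by fun_prop) fun ζ hζ => ?_
      rw [mem_closedBall_zero_iff] at hζ
      rw [mem_ball_zero_iff] at hw ⊢
      rw [norm_mul]
      nlinarith [norm_nonneg w, norm_nonneg ζ]
    have h := DiffContOnCl.circleAverage (c := (0 : ℂ)) (R := 1)
      (f := fun ζ => toFun f (ζ * w)) (by
        rw [abs_one]
        apply DifferentiableOn.diffContOnCl
        rwa [closure_ball _ one_ne_zero])
    rw [Real.circleAverage_def, intervalIntegral.integral_of_le (by positivity)] at h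
    rw [inv_smul_eq_iff₀ (by positivity)] at h
    simpa using h
  have h3 := integral_integral_swap (f := fun θ w => toFun f (circleMap 0 1 θ * w)) hint
  simp only [h1] at h3
  rw [integral_congr_ae (ae_mem_ball.mono h2)] at h3
  simp only [integral_const, ν, Measure.real, Measure.restrict_apply_univ, Real.volume_Ioc,
    measure_univ, sub_zero, ENNReal.toReal_one, one_smul] at h3
  rw [ENNReal.toReal_ofReal (by positivity)] at h3
  exact smul_right_injective ℂ (by positivity : (2 * Real.pi) ≠ 0) h3

lemma zero_mem_ball : (0 : ℂ) ∈ ball (0 : ℂ) 1 := by simp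

lemma inner_one (f : L2a) : inner ℂ one f = toFun f 0 := by
  rw [inner_eq_integral, ← integral_toFun]
  apply integral_congr_ae
  filter_upwards [ae_mem_ball] with w hw
  rw [toFun_one hw]
  simp

/-- The explicit Bergman kernel comes from here: the mean value property at `0` is transported to
`z` by the self-adjoint involution `U z`, without an orthonormal basis. -/
lemma inner_U_one (z : 𝔻) (f : L2a) :
    inner ℂ (U z one) f = -((1 - ‖(z : ℂ)‖ ^ 2 : ℝ) : ℂ) * toFun f z := by
  rw [inner_U_left, inner_one, toFun_U z f zero_mem_ball, pullback, deriv_phi z zero_mem_ball]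
  simp [phi, mul_comm]

lemma U_one (z : 𝔻) : U z one = -((1 - ‖(z : ℂ)‖ ^ 2 : ℝ) : ℂ) • K z := by
  refine ext_inner_right ℂ fun f => ?_
  rw [inner_U_one, L2a.inner_smul_left, inner_K]
  simp

lemma K_eq (z : 𝔻) : K z = -((1 - ‖(z : ℂ)‖ ^ 2 : ℝ) : ℂ)⁻¹ • U z one := by
  have h : ((1 - ‖(z : ℂ)‖ ^ 2 : ℝ) : ℂ) ≠ 0 := by
    exact_mod_cast (one_sub_sq_pos (coe_mem_ball z)).ne'
  rw [U_one, smul_smul, neg_mul_neg, inv_mul_cancel₀ h, one_smul]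

lemma K_zero : K 0 = one := by
  refine ext_inner_right ℂ fun f => ?_
  rw [inner_K, inner_one, UnitDisc.coe_zero]

lemma norm_one : ‖one‖ = 1 := by
  have h : inner ℂ one one = (1 : ℂ) := by rw [inner_one, toFun_one zero_mem_ball]
  rw [L2a.inner_self] at h
  have h' : ‖one‖ ^ 2 = 1 := by exact_mod_cast h
  exact (pow_eq_one_iff_of_nonneg (norm_nonneg _) two_ne_zero).1 h'

lemma norm_K (z : 𝔻) : ‖K z‖ = (1 - ‖(z : ℂ)‖ ^ 2)⁻¹ := by
  rw [K_eq, norm_smul, norm_neg, norm_inv, Complex.norm_real, (U z).norm_map, norm_one, mul_one,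
    Real.norm_eq_abs, abs_of_pos (one_sub_sq_pos (coe_mem_ball z))]

lemma k_eq (z : 𝔻) : k z = -U z one := by
  rw [k, norm_K, U_one, neg_smul, neg_neg]
  push_cast
  rw [inv_inv]

lemma norm_k (z : 𝔻) : ‖k z‖ = 1 := by
  rw [k_eq, norm_neg, (U z).norm_map, norm_one]

lemma toFun_K (z : 𝔻) {w : ℂ} (hw : w ∈ ball (0 : ℂ) 1) :
    toFun (K z) w = 1 / (1 - conj (z : ℂ) * w) ^ 2 := by
  have h : ((1 - ‖(z : ℂ)‖ ^ 2 : ℝ) : ℂ) ≠ 0 := by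
    exact_mod_cast (one_sub_sq_pos (coe_mem_ball z)).ne'
  rw [K_eq, toFun_smul _ _ hw, Pi.smul_apply, toFun_U z _ hw, pullback,
    toFun_one (phi_mem z hw), deriv_phi z hw, one_mul, smul_eq_mul]
  have := den_ne z hw
  field_simp

/-- The image of a point of the disk under a disk automorphism. -/
noncomputable def phiD (z w : 𝔻) : 𝔻 :=
  UnitDisc.mk (phi z w) (mem_ball_zero_iff.1 (phi_mem z (coe_mem_ball w)))

lemma U_K (z w : 𝔻) : U z (K w) = conj (deriv (phi z) w) • K (phiD z w) := by
  refine ext_inner_right ℂ fun f => ?_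
  rw [inner_U_left, inner_K, L2a.inner_smul_left, inner_K, toFun_U z f (coe_mem_ball w), pullback,
    phiD, UnitDisc.coe_mk]
  simp [mul_comm]

lemma inner_conjBy (S : L2a →L[ℂ] L2a) (z : 𝔻) (f g : L2a) :
    inner ℂ f (conjBy S z g) = inner ℂ (U z f) (S (U z g)) := by
  rw [inner_U_left]; rfl

lemma norm_conjBy_apply_le (S : L2a →L[ℂ] L2a) (z : 𝔻) (f : L2a) :
    ‖conjBy S z f‖ ≤ ‖S‖ * ‖f‖ := by
  have : ‖conjBy S z f‖ = ‖S (U z f)‖ := (U z).norm_map _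
  rw [this, ← (U z).norm_map f]
  exact S.le_opNorm _

lemma norm_conjBy_one (S : L2a →L[ℂ] L2a) (z : 𝔻) : ‖conjBy S z one‖ = ‖S (k z)‖ := by
  have : ‖conjBy S z one‖ = ‖S (U z one)‖ := (U z).norm_map _
  rw [this, k_eq, map_neg, norm_neg]

/-- The Berezin transform of a conjugated operator is the Berezin transform of the operator
composed with the disk automorphism. -/
lemma inner_K_conjBy_K (S : L2a →L[ℂ] L2a) (z w : 𝔻) :
    inner ℂ (K w) (conjBy S z (K w)) = (‖K w‖ ^ 2 : ℝ) * berezin S (phiD z w) := by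
  have hK : (‖K (phiD z w)‖ : ℂ) ≠ 0 := by
    rw [norm_K]
    exact_mod_cast (inv_pos.2 (one_sub_sq_pos (coe_mem_ball (phiD z w)))).ne'
  have hn : ‖K w‖ = ‖deriv (phi z) w‖ * ‖K (phiD z w)‖ := by
    rw [← (U z).norm_map, U_K, norm_smul, RCLike.norm_conj]
  rw [inner_conjBy, U_K, hn, berezin, k, map_smul, map_smul, L2a.inner_smul_left, L2a.inner_smul_right,
    L2a.inner_smul_left, L2a.inner_smul_right]
  push_cast
  rw [mul_pow, ← Complex.conj_mul' (deriv (phi z) w)]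
  simp only [RCLike.conj_conj, map_inv₀, Complex.conj_ofReal]
  field_simp

/-! ### Weights and Forelli–Rudin estimates. -/

/-- The weight `(1 - |w|²)^(-t)` on the disk. -/
noncomputable def wt (t : ℝ) (w : ℂ) : ℝ≥0∞ := ENNReal.ofReal (1 - ‖w‖ ^ 2) ^ (-t)

lemma measurable_wt (t : ℝ) : Measurable (wt t) := by
  unfold wt; fun_prop

lemma ofReal_one_sub_ne_zero {w : ℂ} (hw : w ∈ ball (0 : ℂ) 1) :
    ENNReal.ofReal (1 - ‖w‖ ^ 2) ≠ 0 := by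
  simpa using one_sub_sq_pos hw

lemma wt_ne_zero (t : ℝ) {w : ℂ} (hw : w ∈ ball (0 : ℂ) 1) : wt t w ≠ 0 :=
  (ENNReal.rpow_pos (pos_iff_ne_zero.2 (ofReal_one_sub_ne_zero hw)) ENNReal.ofReal_ne_top).ne'

lemma wt_ne_top (t : ℝ) {w : ℂ} (hw : w ∈ ball (0 : ℂ) 1) : wt t w ≠ ∞ :=
  ENNReal.rpow_ne_top_of_ne_zero (ofReal_one_sub_ne_zero hw) ENNReal.ofReal_ne_top

lemma one_le_wt {t : ℝ} (ht : 0 ≤ t) (w : ℂ) : 1 ≤ wt t w := by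
  rw [wt, ENNReal.rpow_neg, ENNReal.one_le_inv]
  apply ENNReal.rpow_le_one _ ht
  rw [ENNReal.ofReal_le_one]
  nlinarith [norm_nonneg w]

lemma wt_rpow (t r : ℝ) (w : ℂ) : wt t w ^ r = wt (t * r) w := by
  rw [wt, wt, ← ENNReal.rpow_mul, neg_mul]

lemma enorm_den_ne_zero (z : 𝔻) {w : ℂ} (hw : w ∈ ball (0 : ℂ) 1) :
    ‖1 - conj (z : ℂ) * w‖ₑ ≠ 0 := enorm_ne_zero.2 (den_ne z hw)

lemma wt_phi (t : ℝ) (z : 𝔻) {w : ℂ} (hw : w ∈ ball (0 : ℂ) 1) :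
    wt t (phi z w) = wt t z * wt t w * ‖1 - conj (z : ℂ) * w‖ₑ ^ (2 * t) := by
  have hd : 0 < ‖1 - conj (z : ℂ) * w‖ := norm_pos_iff.2 (den_ne z hw)
  rw [wt, one_sub_norm_phi_sq z hw, ENNReal.ofReal_div_of_pos (by positivity), div_eq_mul_inv,
    ENNReal.ofReal_mul (one_sub_sq_pos (coe_mem_ball z)).le, wt, wt,
    ENNReal.mul_rpow_of_ne_zero
      (mul_ne_zero (ofReal_one_sub_ne_zero (coe_mem_ball z)) (ofReal_one_sub_ne_zero hw))
      (ENNReal.inv_ne_zero.2 ENNReal.ofReal_ne_top),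
    ENNReal.mul_rpow_of_ne_zero (ofReal_one_sub_ne_zero (coe_mem_ball z))
      (ofReal_one_sub_ne_zero hw)]
  congr 1
  rw [ENNReal.inv_rpow, ENNReal.rpow_neg, inv_inv, ENNReal.ofReal_pow hd.le, ofReal_norm,
    ENNReal.rpow_mul]
  norm_num

lemma wt_one_mul_enorm_deriv_phi (z : 𝔻) {w : ℂ} (hw : w ∈ ball (0 : ℂ) 1) :
    wt 1 z * ‖deriv (phi z) w‖ₑ = ‖1 - conj (z : ℂ) * w‖ₑ ^ (-2 : ℝ) := by
  have hd : 0 < ‖1 - conj (z : ℂ) * w‖ := norm_pos_iff.2 (den_ne z hw)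
  have hz := ofReal_one_sub_ne_zero (coe_mem_ball z)
  rw [← ofReal_norm (deriv (phi z) w), norm_deriv_phi z hw,
    ENNReal.ofReal_div_of_pos (by positivity), wt, ENNReal.rpow_neg_one, div_eq_mul_inv,
    ← mul_assoc, ENNReal.inv_mul_cancel hz ENNReal.ofReal_ne_top, one_mul,
    ENNReal.ofReal_pow hd.le, ofReal_norm, ENNReal.rpow_neg]
  norm_num

lemma toFun_comp_K (S : L2a →L[ℂ] L2a) (z : 𝔻) {w : ℂ} (hw : w ∈ ball (0 : ℂ) 1) :
    ‖toFun (S (K z)) w‖ₑ =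
      wt 1 z * (‖toFun (conjBy S z one) (phi z w)‖ₑ * ‖deriv (phi z) w‖ₑ) := by
  have h1 : S (K z) = -((1 - ‖(z : ℂ)‖ ^ 2 : ℝ) : ℂ)⁻¹ • U z (conjBy S z one) := by
    conv_lhs => rw [K_eq, map_smul, ← U_U z (S (U z one))]
    rfl
  have h2 : ‖-((1 - ‖(z : ℂ)‖ ^ 2 : ℝ) : ℂ)⁻¹‖ₑ = wt 1 z := by
    have hp := one_sub_sq_pos (coe_mem_ball z)
    rw [← ofReal_norm, norm_neg, norm_inv, Complex.norm_real, Real.norm_eq_abs, abs_of_pos hp,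
      ENNReal.ofReal_inv_of_pos hp, wt, ENNReal.rpow_neg_one]
  rw [h1, toFun_smul _ _ hw, Pi.smul_apply, toFun_U z _ hw, pullback, smul_eq_mul, enorm_mul,
    enorm_mul, h2]

/-- The weighted `L¹` norm of `S K_z` in terms of `S_z 1`. -/
lemma lintegral_comp_K_mul_wt (S : L2a →L[ℂ] L2a) (z : 𝔻) (a : ℝ) :
    ∫⁻ w, ‖toFun (S (K z)) w‖ₑ * wt a w ∂dA =
      wt a z * ∫⁻ w, ‖toFun (conjBy S z one) w‖ₑ *
        (‖1 - conj (z : ℂ) * w‖ₑ ^ (-(2 - 2 * a)) * wt a w) ∂dA := by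
  rw [← lintegral_const_mul' _ _ (wt_ne_top a (coe_mem_ball z)), ← lintegral_comp_phi z]
  apply lintegral_congr_ae
  filter_upwards [ae_mem_ball] with w hw
  -- One factor of the Jacobian `|φ_z'(w)|²` cancels against `φ_z'(φ_z(w))`; the other combines with
  -- `wt 1 z` to give `|1 - z̄w|^(-2)`.
  have h1 : ‖deriv (phi z) (phi z w)‖ₑ * ‖deriv (phi z) w‖ₑ = 1 := by
    rw [← enorm_mul, deriv_phi_mul_deriv_phi z hw, enorm_one]
  have h2 := wt_one_mul_enorm_deriv_phi z hw
  have h3 : ‖1 - conj (z : ℂ) * w‖ₑ ^ (-(2 - 2 * a)) =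
      ‖1 - conj (z : ℂ) * w‖ₑ ^ (-2 : ℝ) * ‖1 - conj (z : ℂ) * w‖ₑ ^ (2 * a) := by
    rw [← ENNReal.rpow_add _ _ (enorm_den_ne_zero z hw) enorm_ne_top]
    ring_nf
  rw [toFun_comp_K S z (phi_mem z hw), phi_phi z hw, wt_phi a z hw, h3, ← h2]
  calc _ = (‖deriv (phi z) (phi z w)‖ₑ * ‖deriv (phi z) w‖ₑ) * (‖deriv (phi z) w‖ₑ * (wt 1 z *
        ‖toFun (conjBy S z one) w‖ₑ) * (wt a z * wt a w *
          ‖1 - conj (z : ℂ) * w‖ₑ ^ (2 * a))) := by ring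
    _ = _ := by rw [h1]; ring

lemma one_sub_norm_le {z w : ℂ} (hz : ‖z‖ ≤ 1) : 1 - ‖w‖ ≤ ‖1 - conj z * w‖ := by
  have h1 := norm_sub_norm_le 1 (conj z * w)
  rw [norm_mul, RCLike.norm_conj] at h1
  simp only [CStarRing.norm_one] at h1
  nlinarith [norm_nonneg w]

/-- Take `ζ = z / |z|`. Then `1 - ζ̄w` differs from `1 - z̄w` by `(1 - |z|) ζ̄w`, whose norm is at
most `1 - |z| ≤ |1 - z̄w|`. This makes integrals over all `z` comparable to a single one. -/
lemma exists_unit_norm_one_sub_le (z : 𝔻) : ∃ ζ : ℂ, ‖ζ‖ = 1 ∧ ∀ w ∈ ball (0 : ℂ) 1,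
    ‖1 - conj ζ * w‖ ≤ 2 * ‖1 - conj (z : ℂ) * w‖ := by
  obtain ⟨ζ, hζ, hz⟩ : ∃ ζ : ℂ, ‖ζ‖ = 1 ∧ (z : ℂ) = ‖(z : ℂ)‖ * ζ := by
    by_cases h : (z : ℂ) = 0
    · exact ⟨1, by simp, by simp [h]⟩
    · refine ⟨z / ‖(z : ℂ)‖, by simp [h], ?_⟩
      have : (‖(z : ℂ)‖ : ℂ) ≠ 0 := by simpa using h
      field_simp
  refine ⟨ζ, hζ, fun w hw => ?_⟩
  rw [mem_ball_zero_iff] at hw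
  have h1 : 1 - ‖(z : ℂ)‖ ≤ ‖1 - conj (z : ℂ) * w‖ := by
    have h1 := norm_sub_norm_le 1 (conj (z : ℂ) * w)
    rw [norm_mul, RCLike.norm_conj] at h1
    simp only [CStarRing.norm_one] at h1
    nlinarith [norm_nonneg (z : ℂ)]
  have h2 : 1 - conj ζ * w = (1 - conj (z : ℂ) * w) - (1 - ‖(z : ℂ)‖ : ℝ) * (conj ζ * w) := by
    conv_rhs => rw [hz]
    simp [hζ]
    ring
  have h3 : ‖((1 - ‖(z : ℂ)‖ : ℝ) : ℂ) * (conj ζ * w)‖ ≤ 1 - ‖(z : ℂ)‖ := by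
    rw [norm_mul, norm_mul, RCLike.norm_conj, hζ, Complex.norm_real, Real.norm_eq_abs,
      abs_of_pos (by linarith [z.norm_lt_one])]
    nlinarith [z.norm_lt_one]
  rw [h2]
  refine (norm_sub_le _ _).trans ?_
  linarith

/-- Jordan's inequality gives `|1 - e^{iθ}| = 2 sin(|θ|/2) ≥ 2|θ|/π`. Moving radially from `e^{iθ}`
to `ρe^{iθ}` costs `1 - ρ`, itself at most `|1 - ρe^{iθ}|`. -/
lemma abs_div_pi_le_norm_one_sub {ρ θ : ℝ} (hρ : ρ ∈ Ioo (0 : ℝ) 1)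
    (hθ : θ ∈ Ioo (-Real.pi) Real.pi) :
    |θ| / Real.pi ≤ ‖1 - Complex.polarCoord.symm (ρ, θ)‖ := by
  have h0 : Complex.polarCoord.symm (ρ, θ) = ρ * Complex.exp (θ * I) := by
    rw [Complex.polarCoord_symm_apply, Complex.exp_mul_I]
    simp
  have hp := Real.pi_pos
  have h1 : ‖1 - Complex.exp (θ * I)‖ = 2 * Real.sin (|θ| / 2) := by
    rw [norm_sub_rev, mul_comm, Complex.norm_exp_I_mul_ofReal_sub_one]
    rcases abs_cases θ with ⟨h, h'⟩ | ⟨h, h'⟩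
    · rw [h, Real.norm_of_nonneg]
      have := Real.sin_nonneg_of_nonneg_of_le_pi (x := θ / 2) (by linarith) (by linarith [hθ.2])
      positivity
    · rw [h, neg_div, Real.sin_neg, Real.norm_of_nonpos]
      · ring
      have := Real.sin_nonneg_of_nonneg_of_le_pi (x := -(θ / 2)) (by linarith) (by linarith [hθ.1])
      rw [Real.sin_neg] at this
      linarith
  have habs : |θ| ≤ Real.pi := abs_le.2 ⟨hθ.1.le, hθ.2.le⟩
  have h2 := Real.mul_le_sin (x := |θ| / 2) (by positivity) (by linarith)
  have h3 : 1 - ρ ≤ ‖1 - (ρ : ℂ) * Complex.exp (θ * I)‖ := by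
    have h1 := norm_sub_norm_le 1 ((ρ : ℂ) * Complex.exp (θ * I))
    rw [norm_mul, Complex.norm_exp_ofReal_mul_I, Complex.norm_real, Real.norm_of_nonneg hρ.1.le]
      at h1
    simpa using h1
  have h4 : 1 - Complex.exp (θ * I) =
      (1 - (ρ : ℂ) * Complex.exp (θ * I)) - (1 - ρ : ℝ) * Complex.exp (θ * I) := by
    push_cast; ring
  have h5 : ‖1 - Complex.exp (θ * I)‖ ≤ ‖1 - (ρ : ℂ) * Complex.exp (θ * I)‖ + (1 - ρ) := by
    rw [h4]
    refine (norm_sub_le _ _).trans ?_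
    rw [norm_mul, Complex.norm_exp_ofReal_mul_I, Complex.norm_real,
      Real.norm_of_nonneg (by linarith [hρ.2]), mul_one]
  rw [h0]
  have h6 : |θ| / Real.pi = 2 / Real.pi * (|θ| / 2) := by ring
  rw [h6]
  linarith

lemma lintegral_Ioo_rpow_neg_lt_top {κ : ℝ} (hκ : κ < 1) :
    ∫⁻ x in Ioo (0 : ℝ) 1, ENNReal.ofReal x ^ (-κ) < ∞ := by
  have h1 : IntegrableOn (fun x : ℝ => x ^ (-κ)) (Ioo 0 1) := by
    have := intervalIntegral.intervalIntegrable_rpow' (a := 0) (b := 1) (r := -κ) (by linarith)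
    rw [intervalIntegrable_iff_integrableOn_Ioo_of_le zero_le_one] at this
    exact this
  have h2 := h1.2
  rw [hasFiniteIntegral_iff_ofReal] at h2
  · refine lt_of_eq_of_lt (setLIntegral_congr_fun measurableSet_Ioo fun x hx => ?_) h2
    rw [ENNReal.ofReal_rpow_of_pos hx.1]
  · filter_upwards [ae_restrict_mem measurableSet_Ioo] with x hx
    exact Real.rpow_nonneg hx.1.le _

lemma ennreal_rpow_neg_le_rpow_neg {a b : ℝ≥0∞} (h : a ≤ b) {s : ℝ} (hs : 0 ≤ s) :
    b ^ (-s) ≤ a ^ (-s) := by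
  rw [ENNReal.rpow_neg, ENNReal.rpow_neg]
  exact ENNReal.inv_le_inv.2 (ENNReal.rpow_le_rpow h hs)

/-- In polar coordinates `|1 - w|` dominates both `1 - ρ` and `|θ|/π`. The power `s` is shared
between these two bounds so that, with the weight included, each variable carries the same exponent
`κ = (s + t)/2 < 1`; the bound is then a product of two convergent integrals. -/
lemma lintegral_one_sub_rpow_lt_top {s t : ℝ} (ht : 0 ≤ t) (hts : t ≤ s) (hst : s + t < 2) :
    ∫⁻ w, ‖1 - w‖ₑ ^ (-s) * wt t w ∂dA < ∞ := by
  set κ := (s + t) / 2 with hκ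
  have hκ1 : κ < 1 := by rw [hκ]; linarith
  have hκ0 : 0 ≤ κ := by rw [hκ]; linarith
  let A : ℝ → ℝ≥0∞ := (Ioo (0 : ℝ) 1).indicator fun ρ => ENNReal.ofReal (1 - ρ) ^ (-κ)
  let B : ℝ → ℝ≥0∞ := fun θ => ENNReal.ofReal (|θ| / Real.pi) ^ (-κ)
  have hA : Measurable A := Measurable.indicator (by fun_prop) measurableSet_Ioo
  have hB : Measurable B := by fun_prop
  have hAfin : ∫⁻ ρ in Ioi 0, A ρ < ∞ := by
    refine lt_of_le_of_lt (setLIntegral_le_lintegral _ _) ?_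
    rw [lintegral_indicator measurableSet_Ioo]
    have h := lintegral_Ioo_rpow_neg_lt_top hκ1
    rw [← lintegral_indicator measurableSet_Ioo, ← lintegral_sub_left_eq_self _ (1 : ℝ)] at h
    rw [← lintegral_indicator measurableSet_Ioo]
    refine lt_of_eq_of_lt (lintegral_congr fun x => ?_) h
    by_cases hx : x ∈ Ioo (0 : ℝ) 1
    · have : 1 - x ∈ Ioo (0 : ℝ) 1 := ⟨by linarith [hx.2], by linarith [hx.1]⟩
      rw [indicator_of_mem hx, indicator_of_mem this]
    · have : 1 - x ∉ Ioo (0 : ℝ) 1 := fun h => hx ⟨by linarith [h.2], by linarith [h.1]⟩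
      rw [indicator_of_notMem hx, indicator_of_notMem this]
  have hBfin : ∫⁻ θ in Ioo (-Real.pi) Real.pi, B θ < ∞ := by
    have hp := Real.pi_pos
    have h1 : IntegrableOn (fun x : ℝ => (|x| / Real.pi) ^ (-κ)) (Ioo (-Real.pi) Real.pi) := by
      have hpos : IntegrableOn (fun x : ℝ => (|x| / Real.pi) ^ (-κ)) (Ioo 0 Real.pi) := by
        have := intervalIntegral.intervalIntegrable_rpow' (a := 0) (b := Real.pi) (r := -κ)
          (by linarith)
        rw [intervalIntegrable_iff_integrableOn_Ioo_of_le hp.le] at this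
        refine IntegrableOn.congr_fun (this.mul_const (Real.pi ^ (-κ))⁻¹) (fun x hx => ?_)
          measurableSet_Ioo
        rw [abs_of_pos hx.1, Real.div_rpow hx.1.le hp.le, div_eq_mul_inv]
      have hneg : IntegrableOn (fun x : ℝ => (|x| / Real.pi) ^ (-κ)) (Ioo (-Real.pi) 0) := by
        have h := hpos.comp_neg
        simp only [abs_neg] at h
        convert h using 1
        ext x; simp
      have h0 : IntegrableOn (fun x : ℝ => (|x| / Real.pi) ^ (-κ)) {0} := by simp
      refine ((hneg.union h0).union hpos).mono_set fun x hx => ?_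
      rcases lt_trichotomy x 0 with h | h | h
      · exact .inl (.inl ⟨hx.1, h⟩)
      · exact .inl (.inr h)
      · exact .inr ⟨h, hx.2⟩
    have h2 := h1.2
    rw [hasFiniteIntegral_iff_ofReal (Eventually.of_forall fun x => by positivity)] at h2
    refine lt_of_eq_of_lt (lintegral_congr_ae ?_) h2
    filter_upwards [ae_restrict_of_ae (Measure.ae_ne volume (0 : ℝ))] with x hx
    have : 0 < |x| / Real.pi := by positivity
    simp only [B]
    rw [ENNReal.ofReal_rpow_of_pos this]
  rw [dA, lintegral_smul_measure, smul_eq_mul]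
  refine ENNReal.mul_lt_top (by simp [Real.pi_pos]) ?_
  rw [← lintegral_indicator isOpen_ball.measurableSet, ← Complex.lintegral_comp_polarCoord_symm,
    polarCoord_target, Measure.volume_eq_prod, ← Measure.prod_restrict]
  have hprod : ∫⁻ p : ℝ × ℝ, A p.1 * B p.2
      ∂((volume.restrict (Ioi 0)).prod (volume.restrict (Ioo (-Real.pi) Real.pi))) < ∞ := by
    rw [lintegral_prod_mul hA.aemeasurable hB.aemeasurable]
    exact ENNReal.mul_lt_top hAfin hBfin
  refine lt_of_le_of_lt ?_ hprod
  rw [Measure.prod_restrict]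
  refine setLIntegral_mono' (measurableSet_Ioi.prod measurableSet_Ioo) fun p hp => ?_
  obtain ⟨ρ, θ⟩ := p
  have hρ : 0 < ρ := hp.1
  have hθ : θ ∈ Ioo (-Real.pi) Real.pi := hp.2
  have hn : ‖Complex.polarCoord.symm (ρ, θ)‖ = ρ := by
    rw [Complex.norm_polarCoord_symm, abs_of_pos hρ]
  by_cases hρ1 : ρ < 1
  · have hmem : Complex.polarCoord.symm (ρ, θ) ∈ ball (0 : ℂ) 1 := by
      rwa [mem_ball_zero_iff, hn]
    have hρ' : ρ ∈ Ioo (0 : ℝ) 1 := ⟨hρ, hρ1⟩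
    rw [indicator_of_mem hmem]
    simp only [A, B, indicator_of_mem hρ', smul_eq_mul]
    set w := Complex.polarCoord.symm (ρ, θ) with hw
    have e1 : ENNReal.ofReal ρ ≤ 1 := by rw [ENNReal.ofReal_le_one]; exact hρ1.le
    have e2 : ENNReal.ofReal (1 - ρ) ≤ ‖1 - w‖ₑ := by
      rw [← ofReal_norm]
      apply ENNReal.ofReal_le_ofReal
      have := one_sub_norm_le (z := 1) (w := w) (by simp)
      rw [hn] at this
      simpa using this
    have e3 : ENNReal.ofReal (|θ| / Real.pi) ≤ ‖1 - w‖ₑ := by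
      rw [← ofReal_norm]
      exact ENNReal.ofReal_le_ofReal (abs_div_pi_le_norm_one_sub hρ' hθ)
    have hr0 : ENNReal.ofReal (1 - ρ) ≠ 0 := by simpa using hρ1
    have e4 : wt t w ≤ ENNReal.ofReal (1 - ρ) ^ (-t) := by
      rw [wt, hn]
      apply ennreal_rpow_neg_le_rpow_neg _ ht
      apply ENNReal.ofReal_le_ofReal
      nlinarith
    have hne : ‖1 - w‖ₑ ≠ 0 := fun h => hr0 (le_antisymm (h ▸ e2) zero_le)
    have e5 : ‖1 - w‖ₑ ^ (-s) = ‖1 - w‖ₑ ^ (-((s - t) / 2)) * ‖1 - w‖ₑ ^ (-κ) := by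
      rw [← ENNReal.rpow_add _ _ hne enorm_ne_top]
      congr 1; rw [hκ]; ring
    have e6 : ENNReal.ofReal (1 - ρ) ^ (-κ) =
        ENNReal.ofReal (1 - ρ) ^ (-((s - t) / 2)) * ENNReal.ofReal (1 - ρ) ^ (-t) := by
      rw [← ENNReal.rpow_add _ _ hr0 ENNReal.ofReal_ne_top]
      congr 1; rw [hκ]; ring
    rw [e5, e6]
    have e7 := ennreal_rpow_neg_le_rpow_neg e2 (s := (s - t) / 2) (by linarith)
    have e8 := ennreal_rpow_neg_le_rpow_neg e3 hκ0
    calc _ ≤ 1 * (ENNReal.ofReal (1 - ρ) ^ (-((s - t) / 2)) *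
          ENNReal.ofReal (|θ| / Real.pi) ^ (-κ) * ENNReal.ofReal (1 - ρ) ^ (-t)) := by
          exact mul_le_mul' e1 (mul_le_mul' (mul_le_mul' e7 e8) e4)
      _ = _ := by ring
  · have hmem : Complex.polarCoord.symm (ρ, θ) ∉ ball (0 : ℂ) 1 := by
      rwa [mem_ball_zero_iff, hn]
    rw [indicator_of_notMem hmem]
    simp

/-- Forelli–Rudin type estimate. -/
lemma exists_lintegral_den_rpow_le {s t : ℝ} (ht : 0 ≤ t) (hts : t ≤ s) (hst : s + t < 2) :
    ∃ C : ℝ≥0∞, C ≠ ∞ ∧ ∀ z : 𝔻,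
      ∫⁻ w, ‖1 - conj (z : ℂ) * w‖ₑ ^ (-s) * wt t w ∂dA ≤ C := by
  have hfin := lintegral_one_sub_rpow_lt_top ht hts hst
  have h2 : (2 : ℝ≥0∞) ^ s ≠ ∞ := ENNReal.rpow_ne_top_of_nonneg (ht.trans hts) (by simp)
  refine ⟨2 ^ s * ∫⁻ w, ‖1 - w‖ₑ ^ (-s) * wt t w ∂dA, ENNReal.mul_ne_top h2 hfin.ne, fun z => ?_⟩
  obtain ⟨ζ, hζ, hle⟩ := exists_unit_norm_one_sub_le z
  have hmp := measurePreserving_mul (ζ := conj ζ) (by simpa using hζ)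
  have hm : Measurable fun w : ℂ => ‖1 - w‖ₑ ^ (-s) * wt t w :=
    Measurable.mul (by fun_prop) (measurable_wt t)
  rw [← hmp.lintegral_comp hm, ← lintegral_const_mul' _ _ h2]
  refine lintegral_mono_ae ?_
  filter_upwards [ae_mem_ball] with w hw
  have e1 : wt t (conj ζ * w) = wt t w := by
    rw [wt, wt, norm_mul, RCLike.norm_conj, hζ, one_mul]
  rw [e1, ← mul_assoc]
  gcongr
  have e2 : ‖1 - conj ζ * w‖ₑ ≤ 2 * ‖1 - conj (z : ℂ) * w‖ₑ := by
    rw [← ofReal_norm, ← ofReal_norm, ← ENNReal.ofReal_ofNat 2, ← ENNReal.ofReal_mul (by norm_num)]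
    exact ENNReal.ofReal_le_ofReal (hle w hw)
  have e3 := ennreal_rpow_neg_le_rpow_neg e2 (ht.trans hts)
  rw [ENNReal.mul_rpow_of_ne_zero (by simp) (enorm_den_ne_zero z hw)] at e3
  calc _ = 2 ^ s * (2 ^ (-s) * ‖1 - conj (z : ℂ) * w‖ₑ ^ (-s)) := by
        rw [← mul_assoc, ← ENNReal.rpow_add _ _ (by simp) (by simp), add_neg_cancel,
          ENNReal.rpow_zero, one_mul]
    _ ≤ _ := by gcongr

lemma lintegral_wt_lt_top {t : ℝ} (ht : 0 ≤ t) (ht1 : t < 1) : ∫⁻ w, wt t w ∂dA < ∞ := by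
  obtain ⟨C, hC, h⟩ := exists_lintegral_den_rpow_le ht le_rfl (by linarith)
  refine lt_of_le_of_lt ?_ hC.lt_top
  simpa using h 0

/-- The Bergman kernel reproduces the growth rate `(1 - |z|²)^(-ε)`. -/
lemma exists_lintegral_K_mul_wt_le {ε : ℝ} (h0 : 0 < ε) (h1 : ε ≤ 1 / 2) :
    ∃ C : ℝ≥0∞, C ≠ ∞ ∧ ∀ z : 𝔻, ∫⁻ w, ‖toFun (K z) w‖ₑ * wt ε w ∂dA ≤ C * wt ε z := by
  -- With the identity in place of `S`, the weighted formula leaves the exponents `2 - 2ε` and `ε`.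
  -- Their sum `2 - ε` is below `2` exactly because `ε > 0`.
  obtain ⟨C, hC, h⟩ := exists_lintegral_den_rpow_le (s := 2 - 2 * ε) (t := ε) h0.le
    (by linarith) (by linarith)
  refine ⟨C, hC, fun z => ?_⟩
  have e := lintegral_comp_K_mul_wt (ContinuousLinearMap.id ℂ L2a) z ε
  simp only [ContinuousLinearMap.id_apply] at e
  rw [e, mul_comm]
  gcongr
  refine le_trans (le_of_eq (lintegral_congr_ae ?_)) (h z)
  filter_upwards [ae_mem_ball] with w hw
  have : conjBy (ContinuousLinearMap.id ℂ L2a) z one = one := U_U z one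
  rw [this, toFun_one hw, enorm_one, one_mul]

/-! ### Uniform growth bounds for Toeplitz products and their adjoints. -/

/-- This is all that is used about a Toeplitz operator. The right side is symmetric in `h` and `g`,
so it covers the adjoint, and it is invariant under applying `U z` to both functions. -/
lemma enorm_inner_toeplitz_le (u : Lp ℂ ∞ dA) (h g : L2a) :
    ‖inner ℂ h (toeplitz u g)‖ₑ ≤ ‖u‖ₑ * ∫⁻ w, ‖toFun h w‖ₑ * ‖toFun g w‖ₑ ∂dA := by
  have h1 : inner ℂ h (toeplitz u g) =
      inner ℂ (h : Lp ℂ 2 dA) ((ContinuousLinearMap.mul ℂ ℂ).holderL dA ∞ 2 2 u g) :=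
    L2a.inner_orthogonalProjectionOnto_eq_of_mem_left h _
  rw [h1, L2.inner_def, ← lintegral_const_mul' _ _ enorm_ne_top]
  refine (enorm_integral_le_lintegral_enorm _).trans (lintegral_mono_ae ?_)
  have hu : ∀ᵐ w ∂dA, ‖u w‖ₑ ≤ ‖u‖ₑ := by
    rw [Lp.enorm_def, eLpNorm_exponent_top]
    exact enorm_ae_le_eLpNormEssSup _ _
  have hh : (ContinuousLinearMap.mul ℂ ℂ).holderL dA ∞ 2 2 u g =ᵐ[dA]
      fun w => u w * (g : Lp ℂ 2 dA) w :=
    (ContinuousLinearMap.mul ℂ ℂ).coeFn_holder (r := 2) u (g : Lp ℂ 2 dA)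
  filter_upwards [hu, hh, toFun_ae h, toFun_ae g] with w e1 e2 e3 e4
  rw [e2, e3, e4, RCLike.inner_apply, enorm_mul, enorm_mul]
  have : ‖(starRingEnd ℂ) (toFun h w)‖ₑ = ‖toFun h w‖ₑ := by
    rw [← ofReal_norm, RCLike.norm_conj, ofReal_norm]
  rw [this]
  calc _ ≤ ‖u‖ₑ * ‖toFun g w‖ₑ * ‖toFun h w‖ₑ := by gcongr
    _ = _ := by ring

/-- `T` multiplies, uniformly over all conjugations by disk automorphisms, the growth rate
`(1 - |w|²)^(-ε)` by at most a constant, for all small `ε`. -/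
def GrowthBounded (T : L2a →L[ℂ] L2a) : Prop :=
  ∀ ε : ℝ, 0 < ε → ε ≤ 1 / 2 → ∃ C : ℝ≥0∞, C ≠ ∞ ∧ ∀ (z : 𝔻) (f : L2a) (c : ℝ≥0∞),
    (∀ w ∈ ball (0 : ℂ) 1, ‖toFun f w‖ₑ ≤ c * wt ε w) →
      ∀ w ∈ ball (0 : ℂ) 1, ‖toFun (conjBy T z f) w‖ₑ ≤ C * c * wt ε w

lemma lintegral_U_mul_U (z : 𝔻) (f g : L2a) :
    ∫⁻ w, ‖toFun (U z f) w‖ₑ * ‖toFun (U z g) w‖ₑ ∂dA =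
      ∫⁻ w, ‖toFun f w‖ₑ * ‖toFun g w‖ₑ ∂dA := by
  rw [← lintegral_comp_phi z (fun w => ‖toFun f w‖ₑ * ‖toFun g w‖ₑ)]
  apply lintegral_congr_ae
  filter_upwards [ae_mem_ball] with w hw
  rw [toFun_U z f hw, toFun_U z g hw, pullback, pullback, enorm_mul, enorm_mul]
  ring

/-- The value at `w` is `⟨U_z K_w, T U_z f⟩`. By invariance under `U z` the hypothesis bounds it by
`M ∫ |K_w| |f|`, and `|K_w|` integrates the weight to a multiple of its value at `w`. -/
lemma GrowthBounded.of_enorm_inner_le {T : L2a →L[ℂ] L2a} {M : ℝ≥0∞} (hM : M ≠ ∞)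
    (h : ∀ f g : L2a, ‖inner ℂ f (T g)‖ₑ ≤ M * ∫⁻ w, ‖toFun f w‖ₑ * ‖toFun g w‖ₑ ∂dA) :
    GrowthBounded T := by
  intro ε h0 h1
  obtain ⟨C, hC, hK⟩ := exists_lintegral_K_mul_wt_le h0 h1
  refine ⟨M * C, ENNReal.mul_ne_top hM hC, fun z f c hf w hw => ?_⟩
  lift w to 𝔻 using mem_ball_zero_iff.1 hw
  rw [← inner_K, inner_conjBy]
  refine (h _ _).trans ?_
  rw [lintegral_U_mul_U]
  calc _ ≤ M * ∫⁻ v, c * (‖toFun (K w) v‖ₑ * wt ε v) ∂dA := by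
        gcongr 1
        refine lintegral_mono_ae ?_
        filter_upwards [ae_mem_ball] with v hv
        calc _ ≤ ‖toFun (K w) v‖ₑ * (c * wt ε v) := by gcongr; exact hf v hv
          _ = _ := by ring
    _ = M * (c * ∫⁻ v, ‖toFun (K w) v‖ₑ * wt ε v ∂dA) := by
        congr 1
        exact lintegral_const_mul'' _
          ((aestronglyMeasurable_of_diff (toFun_diff _)).enorm.mul (measurable_wt ε).aemeasurable)
    _ ≤ M * (c * (C * wt ε w)) := by gcongr; exact hK w
    _ = _ := by ring

lemma growthBounded_toeplitz (u : Lp ℂ ∞ dA) : GrowthBounded (toeplitz u) :=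
  .of_enorm_inner_le enorm_ne_top (enorm_inner_toeplitz_le u)

lemma growthBounded_adjoint_toeplitz (u : Lp ℂ ∞ dA) :
    GrowthBounded (ContinuousLinearMap.adjoint (toeplitz u)) := by
  refine .of_enorm_inner_le (M := ‖u‖ₑ) enorm_ne_top fun f g => ?_
  have h : ‖inner ℂ f (ContinuousLinearMap.adjoint (toeplitz u) g)‖ₑ =
      ‖inner ℂ g (toeplitz u f)‖ₑ := by
    rw [ContinuousLinearMap.adjoint_inner_right, ← ofReal_norm, ← ofReal_norm, norm_inner_symm]
  rw [h]
  refine (enorm_inner_toeplitz_le u g f).trans (le_of_eq ?_)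
  simp only [mul_comm]

lemma growthBounded_one : GrowthBounded 1 := by
  intro ε _ _
  refine ⟨1, ENNReal.one_ne_top, fun z f c hf w hw => ?_⟩
  have : conjBy 1 z f = f := U_U z f
  rw [this, one_mul]
  exact hf w hw

lemma growthBounded_zero : GrowthBounded 0 := by
  intro ε _ _
  refine ⟨0, ENNReal.zero_ne_top, fun z f c _ w hw => ?_⟩
  have h1 : conjBy 0 z f = (0 : ℂ) • f := by
    rw [zero_smul]
    exact (U z).map_zero
  rw [h1, toFun_smul _ _ hw]
  simp

/-- Since `U z` is an involution, conjugation is multiplicative, and growth bounds for the same `ε`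
compose without loss in the exponent. -/
lemma GrowthBounded.mul {S T : L2a →L[ℂ] L2a} (hS : GrowthBounded S) (hT : GrowthBounded T) :
    GrowthBounded (S * T) := by
  intro ε h0 h1
  obtain ⟨C, hC, h⟩ := hS ε h0 h1
  obtain ⟨D, hD, h'⟩ := hT ε h0 h1
  refine ⟨C * D, ENNReal.mul_ne_top hC hD, fun z f c hf w hw => ?_⟩
  have e : conjBy (S * T) z f = conjBy S z (conjBy T z f) := by
    change U z (S (T (U z f))) = U z (S (U z (U z (T (U z f)))))
    rw [U_U]
  rw [e, mul_assoc C]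
  exact h z _ _ (h' z f c hf) w hw

lemma GrowthBounded.add {S T : L2a →L[ℂ] L2a} (hS : GrowthBounded S) (hT : GrowthBounded T) :
    GrowthBounded (S + T) := by
  intro ε h0 h1
  obtain ⟨C, hC, h⟩ := hS ε h0 h1
  obtain ⟨D, hD, h'⟩ := hT ε h0 h1
  refine ⟨C + D, ENNReal.add_ne_top.2 ⟨hC, hD⟩, fun z f c hf w hw => ?_⟩
  have e : conjBy (S + T) z f = conjBy S z f + conjBy T z f := (U z).map_add _ _
  rw [e, toFun_add _ _ hw, Pi.add_apply, add_mul, add_mul]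
  exact (enorm_add_le _ _).trans (add_le_add (h z f c hf w hw) (h' z f c hf w hw))

lemma growthBounded_list_prod (l : List (Lp ℂ ∞ dA)) :
    GrowthBounded (l.map toeplitz).prod ∧
      GrowthBounded (ContinuousLinearMap.adjoint (l.map toeplitz).prod) := by
  induction l with
  | nil =>
    simp only [List.map_nil, List.prod_nil]
    refine ⟨growthBounded_one, ?_⟩
    rw [← ContinuousLinearMap.star_eq_adjoint, star_one]
    exact growthBounded_one
  | cons u l ih =>
    simp only [List.map_cons, List.prod_cons]
    refine ⟨(growthBounded_toeplitz u).mul ih.1, ?_⟩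
    rw [← ContinuousLinearMap.star_eq_adjoint, star_mul]
    exact ih.2.mul (growthBounded_adjoint_toeplitz u)

lemma growthBounded_sum {ι : Type*} (s : Finset ι) (T : ι → L2a →L[ℂ] L2a)
    (h : ∀ i, GrowthBounded (T i) ∧ GrowthBounded (ContinuousLinearMap.adjoint (T i))) :
    GrowthBounded (∑ i ∈ s, T i) ∧
      GrowthBounded (ContinuousLinearMap.adjoint (∑ i ∈ s, T i)) := by
  classical
  induction s using Finset.induction_on with
  | empty =>
    rw [Finset.sum_empty, ← ContinuousLinearMap.star_eq_adjoint, star_zero]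
    exact ⟨growthBounded_zero, growthBounded_zero⟩
  | insert i s hi ih =>
    rw [Finset.sum_insert hi, map_add]
    exact ⟨(h i).1.add ih.1, (h i).2.add ih.2⟩

lemma GrowthBounded.exists_conjBy_one_le {T : L2a →L[ℂ] L2a} (hT : GrowthBounded T) {ε : ℝ}
    (h0 : 0 < ε) (h1 : ε ≤ 1 / 2) : ∃ C : ℝ≥0∞, C ≠ ∞ ∧ ∀ (z : 𝔻), ∀ w ∈ ball (0 : ℂ) 1,
      ‖toFun (conjBy T z one) w‖ₑ ≤ C * wt ε w := by
  obtain ⟨C, hC, h⟩ := hT ε h0 h1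
  refine ⟨C, hC, fun z w hw => ?_⟩
  have := h z one 1 (fun v hv => ?_) w hw
  · rwa [mul_one] at this
  · rw [toFun_one hv, enorm_one, one_mul]
    exact one_le_wt h0.le v

end Bergman

/-! ### Weak limits in Hilbert space. -/

section Hilbert

variable {E : Type*} [NormedAddCommGroup E] [InnerProductSpace ℂ E]

lemma tendsto_inner_zero_of_dense_span {α : Type*} {l : Filter α} {v : α → E} {M : ℝ}
    (hv : ∀ z, ‖v z‖ ≤ M) {s : Set E} (hs : Dense (Submodule.span ℂ s : Set E))
    (h : ∀ x ∈ s, Tendsto (fun z => inner ℂ x (v z)) l (𝓝 0)) (g : E) :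
    Tendsto (fun z => inner ℂ g (v z)) l (𝓝 0) := by
  have hspan : ∀ x ∈ Submodule.span ℂ s, Tendsto (fun z => inner ℂ x (v z)) l (𝓝 0) := by
    intro x hx
    induction hx using Submodule.span_induction with
    | mem x hx => exact h x hx
    | zero => simpa using tendsto_const_nhds
    | add x y _ _ hx hy => simpa [inner_add_left] using hx.add hy
    | smul c x _ hx => simpa [inner_smul_left, mul_comm] using hx.const_mul (conj c)
  rw [Metric.tendsto_nhds]
  intro ε hε
  have hM : 0 < |M| + 1 := by positivity
  obtain ⟨x, hx, hxg⟩ := Metric.dense_iff.1 hs g (ε / 2 / (|M| + 1)) (by positivity)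
  filter_upwards [Metric.tendsto_nhds.1 (hspan x hxg) (ε / 2) (by positivity)] with z hz
  rw [dist_zero_right] at hz ⊢
  have e : inner ℂ g (v z) = inner ℂ (g - x) (v z) + inner ℂ x (v z) := by
    rw [inner_sub_left]; ring
  have h1 : ‖inner ℂ (g - x) (v z)‖ ≤ ε / 2 := by
    refine (norm_inner_le_norm _ _).trans ?_
    rw [mem_ball, dist_comm, dist_eq_norm, lt_div_iff₀ hM] at hx
    have h2 : ‖v z‖ ≤ |M| + 1 := (hv z).trans (by linarith [le_abs_self M])
    nlinarith [norm_nonneg (g - x), norm_nonneg (v z)]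
  rw [e]
  refine (norm_add_le _ _).trans_lt ?_
  linarith

/-- Compact operators map bounded weakly null families to norm null families. -/
lemma IsCompactOperator.tendsto_norm_apply_zero [CompleteSpace E] {S : E →L[ℂ] E}
    (hS : IsCompactOperator S) {α : Type*} {l : Filter α} {v : α → E} {M : ℝ}
    (hv : ∀ z, ‖v z‖ ≤ M) (h : ∀ g, Tendsto (fun z => inner ℂ g (v z)) l (𝓝 0)) :
    Tendsto (fun z => ‖S (v z)‖) l (𝓝 0) := by
  have hK : IsCompact (closure (S '' closedBall 0 M)) :=
    hS.isCompact_closure_image_closedBall M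
  have hmem : ∀ z, S (v z) ∈ closure (S '' closedBall 0 M) := fun z =>
    subset_closure ⟨v z, by simpa using hv z, rfl⟩
  have ht : Tendsto (fun z => S (v z)) l (𝓝 0) := by
    refine hK.tendsto_nhds_of_unique_mapClusterPt (Eventually.of_forall hmem) fun y _ hy => ?_
    -- At a cluster point `y`, the numbers `⟨y, S v_z⟩` tend to `0` and also cluster at `⟨y, y⟩`.
    have h1 : Tendsto (fun z => inner ℂ y (S (v z))) l (𝓝 0) := by
      simp only [← ContinuousLinearMap.adjoint_inner_left]
      exact h _
    have h2 : MapClusterPt (inner ℂ y y) l (fun z => inner ℂ y (S (v z))) :=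
      hy.continuousAt_comp (f := fun x => inner ℂ y x) (by fun_prop)
    have h3 : inner ℂ y y = 0 := by
      have : (𝓝 (inner ℂ y y : ℂ) ⊓ 𝓝 0).NeBot := h2.neBot.mono (inf_le_inf_left _ h1)
      exact eq_of_nhds_neBot this
    exact inner_self_eq_zero.1 h3
  simpa using ht.norm

/-- A bounded family of operators has a limit along every ultrafilter, in the weak operator
topology. -/
lemma exists_weak_limit_ultrafilter [CompleteSpace E] {α : Type*} (𝒰 : Ultrafilter α)
    (T : α → E →L[ℂ] E) {M : ℝ} (hT : ∀ z x, ‖T z x‖ ≤ M * ‖x‖) :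
    ∃ T₀ : E →L[ℂ] E, ∀ f g : E,
      Tendsto (fun z => inner ℂ f (T z g)) 𝒰 (𝓝 (inner ℂ f (T₀ g))) := by
  have hlim : ∀ g : E, ∃ y : E, ∀ f, Tendsto (fun z => inner ℂ f (T z g)) 𝒰 (𝓝 (inner ℂ f y)) := by
    intro g
    -- For fixed `g` the functionals `⟨T_z g, ·⟩` stay in a ball, which is weak-* compact by
    -- Banach–Alaoglu, so they converge along the ultrafilter.
    let φ : α → WeakDual ℂ E := fun z =>
      StrongDual.toWeakDual (InnerProductSpace.toDual ℂ E (T z g))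
    have hc := WeakDual.isCompact_closedBall (𝕜 := ℂ) (E := E) 0 (M * ‖g‖)
    obtain ⟨ψ, -, hψ⟩ := hc.ultrafilter_le_nhds (𝒰.map φ) (by
      rw [le_principal_iff]
      refine Filter.mem_map.2 (Eventually.of_forall fun z => ?_)
      simp only [mem_preimage, mem_closedBall, dist_zero_right]
      change ‖InnerProductSpace.toDual ℂ E (T z g)‖ ≤ _
      rw [LinearIsometryEquiv.norm_map]
      exact hT z g)
    refine ⟨(InnerProductSpace.toDual ℂ E).symm (WeakDual.toStrongDual ψ), fun f => ?_⟩
    have h1 : Tendsto (fun z => φ z f) 𝒰 (𝓝 (ψ f)) :=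
      ((WeakDual.eval_continuous f).tendsto ψ).comp hψ
    have h2 := (Complex.continuous_conj.tendsto _).comp h1
    have h3 : conj (ψ f) =
        inner ℂ f ((InnerProductSpace.toDual ℂ E).symm (WeakDual.toStrongDual ψ)) := by
      rw [← inner_conj_symm, InnerProductSpace.toDual_symm_apply]
      rfl
    rw [h3] at h2
    refine h2.congr fun z => ?_
    rw [Function.comp, ← inner_conj_symm]
    rfl
  choose L hL using hlim
  have hadd : ∀ x y, L (x + y) = L x + L y := fun x y => by
    refine ext_inner_left ℂ fun f => tendsto_nhds_unique (hL (x + y) f) ?_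
    simp only [map_add, inner_add_right]
    exact (hL x f).add (hL y f)
  have hsmul : ∀ (c : ℂ) x, L (c • x) = c • L x := fun c x => by
    refine ext_inner_left ℂ fun f => tendsto_nhds_unique (hL (c • x) f) ?_
    simp only [map_smul, inner_smul_right]
    exact (hL x f).const_mul c
  have hbd : ∀ x, ‖L x‖ ≤ M * ‖x‖ := fun x => by
    have h1 : ‖inner ℂ (L x) (L x)‖ ≤ ‖L x‖ * (M * ‖x‖) := by
      refine le_of_tendsto (hL x (L x)).norm (Eventually.of_forall fun z => ?_)
      exact (norm_inner_le_norm _ _).trans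
        (mul_le_mul_of_nonneg_left (hT z x) (norm_nonneg _))
    rw [inner_self_eq_norm_sq_to_K, norm_pow, RCLike.norm_ofReal, abs_norm, sq] at h1
    by_cases h0 : ‖L x‖ = 0
    · rw [h0]
      obtain ⟨z⟩ : Nonempty α := 𝒰.neBot.nonempty
      exact (norm_nonneg _).trans (hT z x)
    · exact le_of_mul_le_mul_left h1 (lt_of_le_of_ne (norm_nonneg _) (Ne.symm h0))
  exact ⟨LinearMap.mkContinuous ⟨⟨L, hadd⟩, hsmul⟩ M hbd, fun f g => hL g f⟩

end Hilbert

/-! ### Holomorphic dependence of the kernel on its parameter, and polarization. -/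

lemma differentiableOn_tsum_succ_mul_pow {E : Type*} [NormedAddCommGroup E] [NormedSpace ℂ E]
    [CompleteSpace E] {v : ℕ → E} (hv : ∀ n, ‖v n‖ ≤ 1) :
    DifferentiableOn ℂ (fun a : ℂ => ∑' n : ℕ, (((n : ℂ) + 1) * a ^ n) • v n) (ball 0 1) := by
  intro a ha
  rw [mem_ball_zero_iff] at ha
  obtain ⟨ρ, haρ, hρ⟩ := exists_between ha
  have hρ0 : 0 ≤ ρ := (norm_nonneg a).trans haρ.le
  have hsum : Summable fun n : ℕ => ((n : ℝ) + 1) * ρ ^ n := by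
    have := summable_choose_mul_geometric_of_norm_lt_one 1 (r := ρ)
      (by rwa [Real.norm_of_nonneg hρ0])
    simpa using this
  have h := differentiableOn_tsum_of_summable_norm hsum (U := ball (0 : ℂ) ρ)
    (F := fun (n : ℕ) a => (((n : ℂ) + 1) * a ^ n) • v n) (fun n => by fun_prop) isOpen_ball
    (fun n b hb => by
      rw [mem_ball_zero_iff] at hb
      rw [norm_smul, norm_mul, norm_pow]
      have h1 : ‖(n : ℂ) + 1‖ = n + 1 := by
        rw [← Nat.cast_succ, Complex.norm_natCast, Nat.cast_succ]
      rw [h1]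
      calc _ ≤ ((n : ℝ) + 1) * ‖b‖ ^ n * 1 := by gcongr; exact hv n
        _ ≤ _ := by rw [mul_one]; gcongr)
  exact (h.differentiableAt (isOpen_ball.mem_nhds (by simpa using haρ))).differentiableWithinAt

/-- A holomorphic function on a disk centred at `0` that vanishes on the real points vanishes. -/
lemma eqOn_zero_of_real_zero {h : ℂ → ℂ} {r : ℝ} (hr : 0 < r)
    (hd : DifferentiableOn ℂ h (ball 0 r)) (h0 : ∀ x : ℝ, |x| < r → h x = 0) :
    ∀ x ∈ ball (0 : ℂ) r, h x = 0 := by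
  have ha : AnalyticOnNhd ℂ h (ball 0 r) := hd.analyticOnNhd isOpen_ball
  refine ha.eqOn_zero_of_preconnected_of_frequently_eq_zero
    (convex_ball (0 : ℂ) r).isPreconnected (mem_ball_self hr) ?_
  have ht : Tendsto (fun x : ℝ => (x : ℂ)) (𝓝[≠] 0) (𝓝[≠] 0) := by
    refine tendsto_nhdsWithin_of_tendsto_nhds_of_eventually_within _ ?_ ?_
    · have := Complex.continuous_ofReal.tendsto 0
      rw [Complex.ofReal_zero] at this
      exact this.mono_left nhdsWithin_le_nhds
    · filter_upwards [self_mem_nhdsWithin] with x hx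
      simpa using hx
  refine ht.frequently (Eventually.frequently ?_)
  have : ∀ᶠ x : ℝ in 𝓝 0, |x| < r := by
    have := Metric.ball_mem_nhds (0 : ℝ) hr
    filter_upwards [this] with x hx
    simpa using hx
  filter_upwards [nhdsWithin_le_nhds this] with x hx using h0 x hx

/-- A function that is holomorphic in two variables and vanishes on the points `(conj b, b)`
vanishes. -/
lemma apply_zero_eq_zero_of_conj_diagonal {E : Type*} [NormedAddCommGroup E] [NormedSpace ℂ E]
    {ψ : ℂ → StrongDual ℂ E} {κ : ℂ → E} (hψ : DifferentiableOn ℂ ψ (ball 0 1))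
    (hκ : DifferentiableOn ℂ κ (ball 0 1)) (hdiag : ∀ b ∈ ball (0 : ℂ) 1, ψ b (κ (conj b)) = 0)
    {w : ℂ} (hw : w ∈ ball (0 : ℂ) 1) : ψ w (κ 0) = 0 := by
  let H : ℂ → ℂ → ℂ := fun a b => ψ b (κ a)
  have hdiff : ∀ {a b : ℂ → ℂ} {s : Set ℂ}, DifferentiableOn ℂ a s → DifferentiableOn ℂ b s →
      MapsTo a s (ball 0 1) → MapsTo b s (ball 0 1) →
      DifferentiableOn ℂ (fun x => H (a x) (b x)) s := by
    intro a b s ha hb hma hmb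
    exact (hψ.fun_comp hb hmb).clm_apply (hκ.fun_comp ha hma)
  have hb1 : ∀ x y : ℂ, ‖x‖ + ‖y‖ < 1 → x - I * y ∈ ball (0 : ℂ) 1 := by
    intro x y h
    rw [mem_ball_zero_iff]
    refine (norm_sub_le _ _).trans_lt ?_
    simpa using h
  have hb2 : ∀ x y : ℂ, ‖x‖ + ‖y‖ < 1 → x + I * y ∈ ball (0 : ℂ) 1 := by
    intro x y h
    rw [mem_ball_zero_iff]
    refine (norm_add_le _ _).trans_lt ?_
    simpa using h
  -- In the coordinates `a = x - iy`, `b = x + iy`, real `x` and `y` give exactly the points `a =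
  -- conj b`. The identity theorem frees `x` here and `y` in the next step; the condition `|x| + |y|
  -- < 1` keeps both arguments in the disk.
  have hreal : ∀ (y : ℝ) (x : ℂ), ‖x‖ + |y| < 1 → H (x - I * y) (x + I * y) = 0 := by
    intro y x hxy
    have hy : |y| < 1 := by linarith [norm_nonneg x]
    have hle : ∀ v ∈ ball (0 : ℂ) (1 - |y|), ‖v‖ + ‖(y : ℂ)‖ < 1 := by
      intro v hv
      rw [mem_ball_zero_iff] at hv
      rw [Complex.norm_real, Real.norm_eq_abs]
      linarith
    refine eqOn_zero_of_real_zero (h := fun x => H (x - I * y) (x + I * y)) (r := 1 - |y|)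
      (by linarith) (hdiff (by fun_prop) (by fun_prop) (fun v hv => hb1 _ _ (hle v hv))
        (fun v hv => hb2 _ _ (hle v hv))) (fun t ht => ?_) x ?_
    · have := hdiag (t + I * y) (hb2 _ _ (hle t (by simpa using ht)))
      convert this using 2
      simp [sub_eq_add_neg]
    · rw [mem_ball_zero_iff]; linarith
  have hall : ∀ x y : ℂ, ‖x‖ + ‖y‖ < 1 → H (x - I * y) (x + I * y) = 0 := by
    intro x y hxy
    have hx : ‖x‖ < 1 := by linarith [norm_nonneg y]
    have hle : ∀ v ∈ ball (0 : ℂ) (1 - ‖x‖), ‖x‖ + ‖v‖ < 1 := by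
      intro v hv
      rw [mem_ball_zero_iff] at hv
      linarith
    refine eqOn_zero_of_real_zero (h := fun y => H (x - I * y) (x + I * y)) (r := 1 - ‖x‖)
      (by linarith) (hdiff (by fun_prop) (by fun_prop) (fun v hv => hb1 _ _ (hle v hv))
        (fun v hv => hb2 _ _ (hle v hv))) (fun t ht => hreal t x (by linarith)) y ?_
    rw [mem_ball_zero_iff]; linarith
  -- These `x` and `y` solve `x - iy = 0`, `x + iy = w`, and satisfy `|x| + |y| = |w| < 1`.
  have h := hall (w / 2) (-I * (w / 2)) (by
    simp only [norm_mul, norm_neg, Complex.norm_I, norm_div, one_mul]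
    norm_num
    exact mem_ball_zero_iff.1 hw)
  have e1 : w / 2 - I * (-I * (w / 2)) = 0 := by
    linear_combination (w / 2) * Complex.I_mul_I
  have e2 : w / 2 + I * (-I * (w / 2)) = w := by
    linear_combination (-w / 2) * Complex.I_mul_I
  rw [e1, e2] at h
  exact h

namespace Bergman

lemma ae_norm_pow_le_one (n : ℕ) : ∀ᵐ w : ℂ ∂dA, ‖w ^ n‖ ≤ 1 := by
  filter_upwards [ae_mem_ball] with w hw
  rw [norm_pow]
  exact pow_le_one₀ (norm_nonneg w) (mem_ball_zero_iff.1 hw).le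

lemma memLp_pow (n : ℕ) : MemLp (fun w : ℂ => w ^ n) 2 dA :=
  MemLp.of_bound (by fun_prop) 1 (ae_norm_pow_le_one n)

/-- The monomial `w ^ n` as an element of the Bergman space. -/
noncomputable def monomial (n : ℕ) : L2a :=
  ⟨(memLp_pow n).toLp, fun w => w ^ n, by fun_prop, MemLp.coeFn_toLp _⟩

lemma toFun_monomial (n : ℕ) : EqOn (toFun (monomial n)) (fun w => w ^ n) (ball 0 1) :=
  toFun_eqOn _ (by fun_prop) (MemLp.coeFn_toLp (memLp_pow n))

lemma norm_monomial_le (n : ℕ) : ‖monomial n‖ ≤ 1 := by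
  change ‖(memLp_pow n).toLp‖ ≤ 1
  rw [Lp.norm_toLp]
  refine ENNReal.toReal_le_of_le_ofReal zero_le_one ?_
  have := eLpNorm_le_of_ae_bound (p := 2) (ae_norm_pow_le_one n)
  simpa using this

/-- The power series `∑ (n + 1) aⁿ wⁿ`, the kernel at the conjugate of `a`. -/
noncomputable def kernelSeries (a : ℂ) : L2a := ∑' n : ℕ, (((n : ℂ) + 1) * a ^ n) • monomial n

lemma differentiableOn_kernelSeries : DifferentiableOn ℂ kernelSeries (ball 0 1) :=
  differentiableOn_tsum_succ_mul_pow norm_monomial_le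

lemma summable_kernelSeries {a : ℂ} (ha : ‖a‖ < 1) :
    Summable fun n : ℕ => (((n : ℂ) + 1) * a ^ n) • monomial n := by
  have hsum : Summable fun n : ℕ => ((n : ℝ) + 1) * ‖a‖ ^ n := by
    have := summable_choose_mul_geometric_of_norm_lt_one 1 (r := ‖a‖)
      (by rwa [norm_norm])
    simpa using this
  refine Summable.of_norm_bounded hsum fun n => ?_
  have h1 : ‖(n : ℂ) + 1‖ = n + 1 := by
    rw [← Nat.cast_succ, Complex.norm_natCast, Nat.cast_succ]
  rw [norm_smul, norm_mul, norm_pow, h1]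
  exact mul_le_of_le_one_right (by positivity) (norm_monomial_le n)

/-- This is `(1 - x)^(-2) = ∑ (n + 1) xⁿ` at `x = z̄w`. The kernel is antiholomorphic in `z`; the
conjugate parameter makes it a norm-convergent holomorphic series. -/
lemma kernelSeries_conj (z : 𝔻) : kernelSeries (conj (z : ℂ)) = K z := by
  apply L2a_ext
  intro w hw
  have hz : ‖conj (z : ℂ)‖ < 1 := by rw [RCLike.norm_conj]; exact z.norm_lt_one
  lift w to 𝔻 using mem_ball_zero_iff.1 hw
  have h1 : HasSum (fun n : ℕ => toFun ((((n : ℂ) + 1) * conj (z : ℂ) ^ n) • monomial n) w)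
      (toFun (kernelSeries (conj (z : ℂ))) w) :=
    (summable_kernelSeries hz).hasSum.mapL (evalAt w)
  have h3 : ‖conj (z : ℂ) * w‖ < 1 := by
    rw [norm_mul]
    nlinarith [norm_nonneg (conj (z : ℂ)), norm_nonneg (w : ℂ), w.norm_lt_one]
  have h4 := hasSum_choose_mul_geometric_of_norm_lt_one 1 h3
  rw [toFun_K z hw]
  have h5 : ∀ n : ℕ, toFun ((((n : ℂ) + 1) * conj (z : ℂ) ^ n) • monomial n) w =
      ((n + 1).choose 1 : ℕ) * (conj (z : ℂ) * w) ^ n := fun n => by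
    rw [toFun_smul _ _ hw, Pi.smul_apply, toFun_monomial n hw, smul_eq_mul, Nat.choose_one_right,
      mul_pow]
    push_cast
    ring
  simp only [h5] at h1
  exact h1.unique h4

/-- The functional `⟨K_b, ·⟩` as a power series in `b`. -/
lemma exists_differentiableOn_inner_K : ∃ ψ : ℂ → StrongDual ℂ L2a,
    DifferentiableOn ℂ ψ (ball 0 1) ∧ ∀ (b : 𝔻) (g : L2a), ψ b g = inner ℂ (K b) g := by
  refine ⟨_, differentiableOn_tsum_succ_mul_pow (v := fun n => innerSL ℂ (monomial n))
    (fun n => ?_), fun b g => ?_⟩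
  · rw [innerSL_apply_norm]; exact norm_monomial_le n
  · have hb : ‖conj (b : ℂ)‖ < 1 := by rw [RCLike.norm_conj]; exact b.norm_lt_one
    have h1 := (summable_kernelSeries hb).hasSum.map (innerSL ℂ (E := L2a))
      (innerSL ℂ (E := L2a)).continuous
    have h2 : (innerSL ℂ (E := L2a)) ∘ (fun n : ℕ => (((n : ℂ) + 1) * conj (b : ℂ) ^ n) • monomial n)
        = fun n : ℕ => (((n : ℂ) + 1) * (b : ℂ) ^ n) • innerSL ℂ (monomial n) := by
      funext n
      ext f
      simp
    rw [h2] at h1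
    rw [h1.tsum_eq]
    change inner ℂ (kernelSeries _) g = _
    rw [kernelSeries_conj]

/-! ### Boundary limits: from the Berezin transform to weak convergence. -/

lemma dense_span_K : Dense (Submodule.span ℂ (range K) : Set L2a) := by
  have h : (Submodule.span ℂ (range K)).topologicalClosure = ⊤ := by
    rw [Submodule.topologicalClosure_eq_top_iff, Submodule.eq_bot_iff]
    intro f hf
    rw [Submodule.mem_orthogonal] at hf
    apply L2a_ext
    intro w hw
    lift w to 𝔻 using mem_ball_zero_iff.1 hw
    rw [← inner_K w f, ← inner_K w 0, hf _ (Submodule.subset_span ⟨w, rfl⟩)]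
    exact (inner_zero_right _).symm
  exact Submodule.dense_iff_topologicalClosure_eq_top.2 h

lemma tendsto_one_sub_sq : Tendsto (fun z : 𝔻 => 1 - ‖(z : ℂ)‖ ^ 2) toBoundary (𝓝 0) := by
  have h1 : Tendsto (fun z : 𝔻 => ‖(z : ℂ)‖) toBoundary (𝓝 1) := tendsto_comap
  simpa using (h1.pow 2).const_sub 1

lemma tendsto_toBoundary_of_one_sub_sq {α : Type*} {l : Filter α} {g : α → 𝔻}
    (h : Tendsto (fun x => 1 - ‖(g x : ℂ)‖ ^ 2) l (𝓝 0)) : Tendsto g l toBoundary := by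
  rw [toBoundary, tendsto_comap_iff]
  have h1 := (h.const_sub 1).sqrt
  simpa [Function.comp_def] using h1

lemma one_sub_pos_of_disc (w : 𝔻) : 0 < 1 - ‖(w : ℂ)‖ := by linarith [w.norm_lt_one]

/-- Since the `k z` are unit vectors, testing against kernels suffices, and `|k_z(w)| = (1 - |z|²) /
|1 - z̄w|²` tends to `0` for fixed `w`. -/
lemma tendsto_inner_k (g : L2a) : Tendsto (fun z => inner ℂ g (k z)) toBoundary (𝓝 0) := by
  refine tendsto_inner_zero_of_dense_span (M := 1) (fun z => (norm_k z).le) dense_span_K ?_ g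
  rintro _ ⟨w, rfl⟩
  have h1 : ∀ z : 𝔻, ‖inner ℂ (K w) (k z)‖ ≤
      (1 - ‖(z : ℂ)‖ ^ 2) * ((1 - ‖(w : ℂ)‖) ^ 2)⁻¹ := by
    intro z
    have hz := one_sub_sq_pos (coe_mem_ball z)
    rw [k, L2a.inner_smul_right, inner_K, toFun_K z (coe_mem_ball w), norm_K]
    rw [norm_mul, Complex.ofReal_inv, inv_inv, Complex.norm_real, Real.norm_eq_abs, abs_of_pos hz,
      one_div, norm_inv, norm_pow]
    have := one_sub_pos_of_disc w
    gcongr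
    exact one_sub_norm_le z.norm_lt_one.le
  refine squeeze_zero_norm h1 ?_
  simpa using tendsto_one_sub_sq.mul_const ((1 - ‖(w : ℂ)‖) ^ 2)⁻¹

lemma tendsto_phiD (w : 𝔻) : Tendsto (fun z => phiD z w) toBoundary toBoundary := by
  apply tendsto_toBoundary_of_one_sub_sq
  have hw := one_sub_sq_pos (coe_mem_ball w)
  have hw' := one_sub_pos_of_disc w
  refine squeeze_zero (g := fun z : 𝔻 => (1 - ‖(z : ℂ)‖ ^ 2) * (1 - ‖(w : ℂ)‖ ^ 2) *
      ((1 - ‖(w : ℂ)‖) ^ 2)⁻¹) (fun z => (one_sub_sq_pos (coe_mem_ball _)).le) (fun z => ?_) ?_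
  · have hz := one_sub_sq_pos (coe_mem_ball z)
    rw [phiD, UnitDisc.coe_mk, one_sub_norm_phi_sq z (coe_mem_ball w), div_eq_mul_inv]
    gcongr
    exact one_sub_norm_le z.norm_lt_one.le
  · simpa [mul_assoc] using
      tendsto_one_sub_sq.mul_const ((1 - ‖(w : ℂ)‖ ^ 2) * ((1 - ‖(w : ℂ)‖) ^ 2)⁻¹)

lemma tendsto_norm_comp_k_of_compact {S : L2a →L[ℂ] L2a} (hS : IsCompactOperator S) :
    Tendsto (fun z => ‖S (k z)‖) toBoundary (𝓝 0) :=
  IsCompactOperator.tendsto_norm_apply_zero hS (M := 1) (fun z => (norm_k z).le) tendsto_inner_k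

/-- An operator whose Berezin transform vanishes identically annihilates the constants. -/
lemma inner_K_apply_one_eq_zero {T : L2a →L[ℂ] L2a}
    (hT : ∀ w : 𝔻, inner ℂ (K w) (T (K w)) = (0 : ℂ)) (w : 𝔻) :
    inner ℂ (K w) (T one) = (0 : ℂ) := by
  -- `⟨K_b, T K_ā⟩` is holomorphic in `a` and `b`. Its values at `a = conj b` are the hypothesis,
  -- and `a = 0` gives `K_0 = 1`.
  obtain ⟨ψ, hψ, hψK⟩ := exists_differentiableOn_inner_K
  have hκ : DifferentiableOn ℂ (fun a => T (kernelSeries a)) (ball 0 1) :=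
    T.differentiable.comp_differentiableOn differentiableOn_kernelSeries
  have h := apply_zero_eq_zero_of_conj_diagonal hψ hκ (fun b hb => by
    lift b to 𝔻 using mem_ball_zero_iff.1 hb
    rw [hψK, kernelSeries_conj, hT]) (coe_mem_ball w)
  have h0 : kernelSeries 0 = one := by
    rw [← K_zero, ← kernelSeries_conj]
    simp
  rwa [hψK, h0] at h

/-- If the Berezin transform vanishes at the boundary, then `S_z 1` tends to zero pointwise. -/
lemma tendsto_inner_K_conjBy_one {S : L2a →L[ℂ] L2a}
    (hS : Tendsto (fun z => berezin S z) toBoundary (𝓝 0)) (w : 𝔻) :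
    Tendsto (fun z => inner ℂ (K w) (conjBy S z one)) toBoundary (𝓝 0) := by
  rw [tendsto_iff_ultrafilter]
  intro 𝒰 h𝒰
  -- Convergence is checked along ultrafilters, where the bounded family `S_z` has a weak operator
  -- limit `T`. Its diagonal values `⟨K_v, T K_v⟩` vanish because `φ_z(v) → ∂D`.
  obtain ⟨T, hT⟩ := exists_weak_limit_ultrafilter 𝒰 (conjBy S) (M := ‖S‖) (norm_conjBy_apply_le S)
  have h0 : ∀ v : 𝔻, inner ℂ (K v) (T (K v)) = (0 : ℂ) := by
    intro v
    refine tendsto_nhds_unique (hT (K v) (K v)) ?_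
    simp only [inner_K_conjBy_K]
    have := (hS.comp (tendsto_phiD v)).const_mul ((‖K v‖ ^ 2 : ℝ) : ℂ)
    rw [mul_zero] at this
    exact this.mono_left h𝒰
  have := hT (K w) one
  rwa [inner_K_apply_one_eq_zero h0] at this

lemma tendsto_inner_conjBy_one {S : L2a →L[ℂ] L2a}
    (hS : Tendsto (fun z => berezin S z) toBoundary (𝓝 0)) (g : L2a) :
    Tendsto (fun z => inner ℂ g (conjBy S z one)) toBoundary (𝓝 0) := by
  refine tendsto_inner_zero_of_dense_span (M := ‖S‖ * ‖one‖) (fun z => norm_conjBy_apply_le S z one)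
    dense_span_K ?_ g
  rintro _ ⟨w, rfl⟩
  exact tendsto_inner_K_conjBy_one hS w

lemma tendsto_toWeakSpace_conjBy_one {S : L2a →L[ℂ] L2a}
    (hS : Tendsto (fun z => berezin S z) toBoundary (𝓝 0)) :
    Tendsto (fun z => toWeakSpace ℂ L2a (conjBy S z one)) toBoundary (𝓝 0) := by
  have hinj : Function.Injective (topDualPairing ℂ L2a).flip := by
    intro f g h
    refine ext_inner_left ℂ fun v => ?_
    exact LinearMap.congr_fun h (innerSL ℂ v)
  refine (WeakBilin.tendsto_iff_forall_eval_tendsto _ hinj).2 fun φ => ?_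
  have h := tendsto_inner_conjBy_one hS ((InnerProductSpace.toDual ℂ L2a).symm φ)
  have e : ∀ f : L2a, inner ℂ ((InnerProductSpace.toDual ℂ L2a).symm φ) f = φ f :=
    fun f => InnerProductSpace.toDual_symm_apply
  simp only [e] at h
  have h0 : (topDualPairing ℂ L2a).flip 0 φ = 0 := map_zero φ
  exact h0 ▸ h

/-- Weak convergence of `S_z 1` implies pointwise convergence. -/
lemma tendsto_toFun_of_weak {α : Type*} {l : Filter α} {f : α → L2a}
    (h : Tendsto (fun z => toWeakSpace ℂ L2a (f z)) l (𝓝 0)) {w : ℂ} (hw : w ∈ ball (0 : ℂ) 1) :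
    Tendsto (fun z => toFun (f z) w) l (𝓝 0) := by
  lift w to 𝔻 using mem_ball_zero_iff.1 hw
  have hc := WeakBilin.eval_continuous (topDualPairing ℂ L2a).flip (evalAt w)
  have h1 := (hc.tendsto 0).comp h
  have h0 : (topDualPairing ℂ L2a).flip 0 (evalAt w) = 0 := map_zero (evalAt w)
  exact h0 ▸ h1

end Bergman

/-! ### The Schur test and compact operator-valued integrals. -/

/-- The Schur test. -/
lemma lintegral_sq_le_of_schur {α β : Type*} [MeasurableSpace α] [MeasurableSpace β]
    {μ : Measure α} {ν : Measure β} [SFinite μ] [SFinite ν] {H : α → β → ℝ≥0∞}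
    (hH : Measurable (Function.uncurry H)) {h₁ : α → ℝ≥0∞} {h₂ : β → ℝ≥0∞} (hm₁ : Measurable h₁)
    (hm₂ : Measurable h₂) (h₁0 : ∀ᵐ z ∂μ, h₁ z ≠ 0) (h₁t : ∀ᵐ z ∂μ, h₁ z ≠ ∞) {A B : ℝ≥0∞}
    (hA : ∀ᵐ z ∂μ, ∫⁻ w, H z w * h₂ w ∂ν ≤ A * h₁ z)
    (hB : ∀ᵐ w ∂ν, ∫⁻ z, H z w * h₁ z ∂μ ≤ B * h₂ w) {g : α → ℝ≥0∞} (hg : Measurable g) :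
    ∫⁻ w, (∫⁻ z, H z w * g z ∂μ) ^ 2 ∂ν ≤ A * B * ∫⁻ z, g z ^ 2 ∂μ := by
  have hHz : ∀ w, Measurable fun z => H z w := fun w => hH.comp measurable_prodMk_right
  have hHw : ∀ z, Measurable fun w => H z w := fun z => hH.comp measurable_prodMk_left
  -- Cauchy–Schwarz for the splitting `H g = (H h₁)^(1/2) (H h₁⁻¹ g²)^(1/2)`.
  have key : ∀ w, (∫⁻ z, H z w * g z ∂μ) ^ 2 ≤
      (∫⁻ z, H z w * h₁ z ∂μ) * ∫⁻ z, H z w * ((h₁ z)⁻¹ * g z ^ 2) ∂μ := by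
    intro w
    have hmw := hHz w
    have h := ENNReal.lintegral_mul_le_Lp_mul_Lq μ Real.HolderConjugate.two_two
      (f := fun z => (H z w * h₁ z) ^ (1 / 2 : ℝ))
      (g := fun z => (H z w * ((h₁ z)⁻¹ * g z ^ 2)) ^ (1 / 2 : ℝ))
      (by fun_prop) (by fun_prop)
    have e1 : ∀ x : ℝ≥0∞, (x ^ (1 / 2 : ℝ)) ^ (2 : ℝ) = x := fun x => by
      rw [← ENNReal.rpow_mul]; norm_num
    simp only [e1] at h
    have e2 : ∫⁻ z, H z w * g z ∂μ = ∫⁻ z, ((fun z => (H z w * h₁ z) ^ (1 / 2 : ℝ)) *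
        fun z => (H z w * ((h₁ z)⁻¹ * g z ^ 2)) ^ (1 / 2 : ℝ)) z ∂μ := by
      apply lintegral_congr_ae
      filter_upwards [h₁0, h₁t] with z z0 zt
      simp only [Pi.mul_apply]
      rw [← ENNReal.mul_rpow_of_nonneg _ _ (by norm_num)]
      have : H z w * h₁ z * (H z w * ((h₁ z)⁻¹ * g z ^ 2)) = (H z w * g z) ^ (2 : ℝ) := by
        rw [ENNReal.rpow_two]
        calc _ = (h₁ z * (h₁ z)⁻¹) * (H z w * g z) ^ 2 := by ring
          _ = _ := by rw [ENNReal.mul_inv_cancel z0 zt, one_mul]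
      rw [this, ← ENNReal.rpow_mul]
      norm_num
    rw [e2]
    calc _ ≤ _ := pow_le_pow_left₀ zero_le h 2
      _ = _ := by
        rw [mul_pow, ← ENNReal.rpow_two, ← ENNReal.rpow_two, e1, e1]
  have hG : Measurable (Function.uncurry fun w z => H z w * ((h₁ z)⁻¹ * g z ^ 2)) := by
    have h1 : Measurable fun p : β × α => H p.2 p.1 := hH.comp measurable_swap
    exact h1.mul (by fun_prop)
  calc _ ≤ ∫⁻ w, B * h₂ w * ∫⁻ z, H z w * ((h₁ z)⁻¹ * g z ^ 2) ∂μ ∂ν := by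
        refine lintegral_mono_ae ?_
        filter_upwards [hB] with w hw
        exact (key w).trans (mul_le_mul_left hw _)
    _ = ∫⁻ w, ∫⁻ z, B * h₂ w * (H z w * ((h₁ z)⁻¹ * g z ^ 2)) ∂μ ∂ν := by
        refine lintegral_congr fun w => ?_
        have hmw := hHz w
        rw [lintegral_const_mul _ (by fun_prop)]
    _ = ∫⁻ z, ∫⁻ w, B * h₂ w * (H z w * ((h₁ z)⁻¹ * g z ^ 2)) ∂ν ∂μ := by
        refine lintegral_lintegral_swap (Measurable.aemeasurable ?_)
        exact Measurable.mul (by fun_prop) hG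
    _ = ∫⁻ z, B * ((h₁ z)⁻¹ * g z ^ 2) * ∫⁻ w, H z w * h₂ w ∂ν ∂μ := by
        refine lintegral_congr fun z => ?_
        have hmz := hHw z
        rw [← lintegral_const_mul _ (by fun_prop)]
        refine lintegral_congr fun w => ?_
        ring
    _ ≤ ∫⁻ z, A * B * g z ^ 2 ∂μ := by
        refine lintegral_mono_ae ?_
        filter_upwards [hA, h₁0, h₁t] with z hz z0 zt
        calc _ ≤ B * ((h₁ z)⁻¹ * g z ^ 2) * (A * h₁ z) := mul_le_mul_right hz _
          _ = ((h₁ z)⁻¹ * h₁ z) * (A * B * g z ^ 2) := by ring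
          _ = _ := by rw [ENNReal.inv_mul_cancel z0 zt, one_mul]
    _ = _ := lintegral_const_mul _ (by fun_prop)

/-- The integrand is continuous into the complete space `V`, so its Bochner integral can be taken
there and mapped back by the inclusion. -/
lemma setIntegral_mem_of_isClosed {X : Type*} [NormedAddCommGroup X] [NormedSpace ℂ X]
    [CompleteSpace X] {V : Submodule ℂ X} (hV : IsClosed (V : Set X)) (μ : Measure ℂ)
    [IsFiniteMeasure μ] {s : Set ℂ} (hs : IsCompact s) {F : ℂ → X} (hF : ContinuousOn F s)
    (hmem : ∀ z, F z ∈ V) : ∫ z in s, F z ∂μ ∈ V := by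
  have : CompleteSpace V := hV.completeSpace_coe
  let G : ℂ → V := fun z => ⟨F z, hmem z⟩
  have hG : ContinuousOn G s := IsInducing.subtypeVal.continuousOn_iff.2 hF
  have hGi : IntegrableOn G s μ := hG.integrableOn_compact hs
  have h1 : ∫ z in s, F z ∂μ = V.subtypeL (∫ z in s, G z ∂μ) :=
    V.subtypeL.integral_comp_comm hGi
  rw [h1]
  exact (∫ z in s, G z ∂μ : V).2

lemma isCompactOperator_setIntegral {E : Type*} [NormedAddCommGroup E] [NormedSpace ℂ E]
    [CompleteSpace E] (μ : Measure ℂ) [IsFiniteMeasure μ] {s : Set ℂ} (hs : IsCompact s)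
    {F : ℂ → E →L[ℂ] E} (hF : ContinuousOn F s) (hmem : ∀ z, IsCompactOperator (F z)) :
    IsCompactOperator (∫ z in s, F z ∂μ : E →L[ℂ] E) := by
  have hV : IsClosed (compactOperator (RingHom.id ℂ) E E : Set (E →L[ℂ] E)) :=
    isClosed_setOfPred_isCompactOperator
  exact setIntegral_mem_of_isClosed hV μ hs hF hmem

/-- With `κ` the Bergman kernel and `s` a closed disk of radius below `1`, this is the Toeplitz
operator of the indicator of `s`. Norm continuity of `κ` makes it an operator-norm integral of
rank-one operators, and compact operators form a closed subspace. -/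
lemma exists_compact_integral_rankOne {E : Type*} [NormedAddCommGroup E] [InnerProductSpace ℂ E]
    [CompleteSpace E] (μ : Measure ℂ) [IsFiniteMeasure μ] {s : Set ℂ} (hs : IsCompact s)
    {κ : ℂ → E} (hκ : ContinuousOn κ s) :
    ∃ R : E →L[ℂ] E, IsCompactOperator R ∧ ∀ x y : E,
      inner ℂ x (R y) = ∫ z in s, inner ℂ x (κ z) * inner ℂ (κ z) y ∂μ := by
  let F : ℂ → E →L[ℂ] E := fun z => (innerSL ℂ (κ z)).smulRight (κ z)
  have hF : ContinuousOn F s := by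
    have h1 : ContinuousOn (fun z => innerSL ℂ (κ z)) s :=
      (innerSL ℂ).continuous.comp_continuousOn hκ
    have h2 : ContinuousOn (fun z => ContinuousLinearMap.smulRightL ℂ E E (innerSL ℂ (κ z))) s :=
      (ContinuousLinearMap.smulRightL ℂ E E).continuous.comp_continuousOn h1
    exact h2.clm_apply hκ
  have hmem : ∀ z, IsCompactOperator (F z) := fun z =>
    ((isCompactOperator_id (E := ℂ)).comp_clm (innerSL ℂ (κ z))).clm_comp
      (ContinuousLinearMap.toSpanSingleton ℂ (κ z))
  refine ⟨_, isCompactOperator_setIntegral μ hs hF hmem, fun x y => ?_⟩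
  have hfi : IntegrableOn F s μ := hF.integrableOn_compact hs
  have h2 : Integrable (fun z => F z y) (μ.restrict s) := hfi.apply_continuousLinearMap y
  rw [ContinuousLinearMap.integral_apply hfi, ← integral_inner h2]
  refine integral_congr_ae (Eventually.of_forall fun z => ?_)
  simp [F, inner_smul_right, mul_comm]

/-! ### `L^p` convergence of `S_z 1` and the kernel estimate from its `L⁶` norm. -/

namespace Bergman

/-- Dominated convergence along `toBoundary` relies on this. -/
instance : (toBoundary).IsCountablyGenerated := by unfold toBoundary; infer_instance

lemma GrowthBounded.exists_rpow_le {S : L2a →L[ℂ] L2a} (hS : GrowthBounded S) {q : ℝ}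
    (hq : 0 < q) : ∃ G : ℂ → ℝ≥0∞, ∫⁻ w, G w ∂dA ≠ ∞ ∧ ∀ (z : 𝔻), ∀ w ∈ ball (0 : ℂ) 1,
      ‖toFun (conjBy S z one) w‖ₑ ^ q ≤ G w := by
  -- The growth exponent after taking `q`-th powers is `εq ≤ 1/2`, so the majorant is integrable.
  set ε := min (1 / 2) (1 / (2 * q)) with hε
  have h0 : 0 < ε := by rw [hε]; positivity
  have hεq : ε * q ≤ 1 / 2 := by
    have : ε ≤ 1 / (2 * q) := min_le_right _ _
    calc ε * q ≤ 1 / (2 * q) * q := by gcongr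
      _ = 1 / 2 := by field_simp
  obtain ⟨C, hC, h⟩ := hS.exists_conjBy_one_le h0 (min_le_left _ _)
  have hCq : C ^ q ≠ ∞ := ENNReal.rpow_ne_top_of_nonneg hq.le hC
  refine ⟨fun w => C ^ q * wt (ε * q) w, ?_, fun z w hw => ?_⟩
  · rw [lintegral_const_mul' _ _ hCq]
    exact ENNReal.mul_ne_top hCq (lintegral_wt_lt_top (by positivity) (by linarith)).ne
  · simp only
    rw [← wt_rpow, ← ENNReal.mul_rpow_of_nonneg _ _ hq.le]
    exact ENNReal.rpow_le_rpow (h z w hw) hq.le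

lemma eLpNorm_coe (f : L2a) (p : ℝ≥0∞) :
    eLpNorm (f : Lp ℂ 2 dA) p dA = eLpNorm (toFun f) p dA :=
  eLpNorm_congr_ae (toFun_ae f)

lemma aemeasurable_enorm_toFun (f : L2a) : AEMeasurable (fun w => ‖toFun f w‖ₑ) dA :=
  (aestronglyMeasurable_of_diff (toFun_diff f)).enorm

lemma GrowthBounded.tendsto_eLpNorm {S : L2a →L[ℂ] L2a} (hS : GrowthBounded S)
    (h : Tendsto (fun z => toWeakSpace ℂ L2a (conjBy S z one)) toBoundary (𝓝 0))
    {p : ℝ≥0∞} (hp1 : 1 < p) (hp : p < ∞) :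
    Tendsto (fun z => eLpNorm (conjBy S z one : Lp ℂ 2 dA) p dA) toBoundary (𝓝 0) := by
  have hp0 : p ≠ 0 := (zero_lt_one.trans hp1).ne'
  have hq : 0 < p.toReal := ENNReal.toReal_pos hp0 hp.ne
  obtain ⟨G, hG, hle⟩ := hS.exists_rpow_le hq
  simp only [eLpNorm_coe]
  simp only [eLpNorm_eq_lintegral_rpow_enorm_toReal hp0 hp.ne]
  have h1 : Tendsto (fun z => ∫⁻ w, ‖toFun (conjBy S z one) w‖ₑ ^ p.toReal ∂dA) toBoundary
      (𝓝 (∫⁻ _, 0 ∂dA)) := by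
    refine tendsto_lintegral_filter_of_dominated_convergence' G
      (Eventually.of_forall fun z => (aemeasurable_enorm_toFun _).pow_const _)
      (Eventually.of_forall fun z => ae_mem_ball.mono (hle z)) hG ?_
    filter_upwards [ae_mem_ball] with w hw
    have h2 := ((tendsto_toFun_of_weak h hw).enorm).ennrpow_const p.toReal
    simpa [hq] using h2
  have h3 := h1.ennrpow_const (1 / p.toReal)
  simpa [hq] using h3

lemma GrowthBounded.exists_eLpNorm_six_le {S : L2a →L[ℂ] L2a} (hS : GrowthBounded S) :
    ∃ M : ℝ≥0∞, M ≠ ∞ ∧ ∀ z, eLpNorm (toFun (conjBy S z one)) 6 dA ≤ M := by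
  obtain ⟨G, hG, hle⟩ := hS.exists_rpow_le (q := 6) (by norm_num)
  refine ⟨(∫⁻ w, G w ∂dA) ^ (1 / 6 : ℝ), ENNReal.rpow_ne_top_of_nonneg (by norm_num) hG,
    fun z => ?_⟩
  rw [eLpNorm_eq_lintegral_rpow_enorm_toReal (by norm_num) (by norm_num)]
  simp only [ENNReal.toReal_ofNat]
  gcongr ?_ ^ _
  exact lintegral_mono_ae (ae_mem_ball.mono (hle z))

/-- The weighted estimate for the kernel of `S` that enters the Schur test. -/
lemma exists_lintegral_comp_K_le : ∃ C : ℝ≥0∞, C ≠ ∞ ∧ ∀ (S : L2a →L[ℂ] L2a) (z : 𝔻),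
    ∫⁻ w, ‖toFun (S (K z)) w‖ₑ * wt (1 / 2) w ∂dA ≤
      C * eLpNorm (toFun (conjBy S z one)) 6 dA * wt (1 / 2) z := by
  -- The weight exponent `1/2` leaves `|1 - z̄w|^(-1) (1 - |w|²)^(-1/2)` beside `S_z 1`. Hölder with
  -- `6` and `6/5` raises the exponents to `6/5` and `3/5`, whose sum is below `2`; any Hölder
  -- exponent above `4` on `S_z 1` would satisfy this.
  obtain ⟨C, hC, h⟩ := exists_lintegral_den_rpow_le (s := 6 / 5) (t := 3 / 5) (by norm_num)
    (by norm_num) (by norm_num)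
  refine ⟨C ^ (1 / (6 / 5) : ℝ), ENNReal.rpow_ne_top_of_nonneg (by norm_num) hC, fun S z => ?_⟩
  have hpq : (6 : ℝ).HolderConjugate (6 / 5) := by
    rw [Real.holderConjugate_iff]; norm_num
  have hw := measurable_wt (1 / 2)
  have hh := ENNReal.lintegral_mul_le_Lp_mul_Lq dA hpq
    (f := fun w => ‖toFun (conjBy S z one) w‖ₑ)
    (g := fun w => ‖1 - conj (z : ℂ) * w‖ₑ ^ (-(2 - 2 * (1 / 2)) : ℝ) * wt (1 / 2) w)
    (aemeasurable_enorm_toFun _) (by fun_prop)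
  rw [lintegral_comp_K_mul_wt, mul_comm]
  gcongr
  refine hh.trans ?_
  rw [mul_comm, eLpNorm_eq_lintegral_rpow_enorm_toReal (by norm_num) (by norm_num)]
  simp only [ENNReal.toReal_ofNat]
  gcongr
  refine le_trans (le_of_eq (lintegral_congr fun w => ?_)) (h z)
  rw [ENNReal.mul_rpow_of_nonneg _ _ (by norm_num), ← ENNReal.rpow_mul, wt_rpow]
  norm_num

end Bergman

lemma isCompactOperator_of_forall_exists_norm_sub_le {E : Type*} [NormedAddCommGroup E]
    [NormedSpace ℂ E] [CompleteSpace E] {S : E →L[ℂ] E}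
    (h : ∀ ε > 0, ∃ R : E →L[ℂ] E, IsCompactOperator R ∧ ∀ f, ‖(S - R) f‖ ≤ ε * ‖f‖) :
    IsCompactOperator S := by
  have hc : IsClosed {T : E →L[ℂ] E | IsCompactOperator T} :=
    isClosed_setOfPred_isCompactOperator
  have hcl : S ∈ closure {T : E →L[ℂ] E | IsCompactOperator T} := by
    rw [Metric.mem_closure_iff]
    intro ε hε
    obtain ⟨R, hR, hle⟩ := h (ε / 2) (by positivity)
    refine ⟨R, hR, ?_⟩
    rw [dist_eq_norm]
    linarith [ContinuousLinearMap.opNorm_le_bound _ (by positivity) hle]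
  rwa [hc.closure_eq] at hcl

/-! ### Compactness from small `L⁶` norms near the boundary. -/

namespace Bergman

lemma enorm_sq_eq_lintegral (f : L2a) : ‖f‖ₑ ^ 2 = ∫⁻ w, ‖toFun f w‖ₑ ^ 2 ∂dA := by
  have h : ‖f‖ₑ = eLpNorm (toFun f) 2 dA := by
    rw [← eLpNorm_coe, ← Lp.enorm_def]
    rfl
  rw [h, eLpNorm_eq_lintegral_rpow_enorm_toReal (by norm_num) (by norm_num), ← ENNReal.rpow_two,
    ← ENNReal.rpow_mul]
  simp

lemma enorm_inner_K_comm (S : L2a →L[ℂ] L2a) (z w : 𝔻) :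
    ‖toFun (ContinuousLinearMap.adjoint S (K w)) z‖ₑ = ‖toFun (S (K z)) w‖ₑ := by
  rw [← inner_K, ← inner_K, ContinuousLinearMap.adjoint_inner_right, ← ofReal_norm, ← ofReal_norm,
    norm_inner_symm]

lemma continuousOn_kernelSeries_conj :
    ContinuousOn (fun z : ℂ => kernelSeries (conj z)) (ball 0 1) := by
  refine differentiableOn_kernelSeries.continuousOn.comp Complex.continuous_conj.continuousOn ?_
  intro z hz
  rw [mem_ball_zero_iff] at hz ⊢
  rwa [RCLike.norm_conj]

/-- The integral kernel of `S`, cut off to `r < |z|`. -/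
noncomputable def cutoffKernel (S : L2a →L[ℂ] L2a) (r : ℝ) (z w : ℂ) : ℝ≥0∞ :=
  ((ball (0 : ℂ) 1 ∩ (closedBall 0 r)ᶜ) ×ˢ ball (0 : ℂ) 1).indicator
    (fun p => ‖inner ℂ (kernelSeries (conj p.2)) (S (kernelSeries (conj p.1)))‖ₑ) (z, w)

lemma measurable_cutoffKernel (S : L2a →L[ℂ] L2a) (r : ℝ) :
    Measurable (Function.uncurry (cutoffKernel S r)) := by
  classical
  have hs : MeasurableSet ((ball (0 : ℂ) 1 ∩ (closedBall 0 r)ᶜ) ×ˢ ball (0 : ℂ) 1) :=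
    ((isOpen_ball.inter isClosed_closedBall.isOpen_compl).prod isOpen_ball).measurableSet
  have h1 : ContinuousOn (fun p : ℂ × ℂ => kernelSeries (conj p.2))
      ((ball (0 : ℂ) 1 ∩ (closedBall 0 r)ᶜ) ×ˢ ball (0 : ℂ) 1) :=
    continuousOn_kernelSeries_conj.comp continuousOn_snd fun p hp => hp.2
  have h2 : ContinuousOn (fun p : ℂ × ℂ => S (kernelSeries (conj p.1)))
      ((ball (0 : ℂ) 1 ∩ (closedBall 0 r)ᶜ) ×ˢ ball (0 : ℂ) 1) :=
    S.continuous.comp_continuousOn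
      (continuousOn_kernelSeries_conj.comp continuousOn_fst fun p hp => hp.1.1)
  have h3 := (ContinuousOn.inner (𝕜 := ℂ) h1 h2).enorm.measurable_piecewise
    (g := fun _ => 0) continuousOn_const hs
  have h4 : Function.uncurry (cutoffKernel S r) =
      ((ball (0 : ℂ) 1 ∩ (closedBall 0 r)ᶜ) ×ˢ ball (0 : ℂ) 1).indicator
    (fun p => ‖inner ℂ (kernelSeries (conj p.2)) (S (kernelSeries (conj p.1)))‖ₑ) := rfl
  rw [h4, ← Set.piecewise_eq_indicator]
  exact h3

lemma cutoffKernel_le (S : L2a →L[ℂ] L2a) (r : ℝ) (z w : 𝔻) :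
    cutoffKernel S r z w ≤ ‖toFun (S (K z)) w‖ₑ := by
  rw [← inner_K, ← kernelSeries_conj w, ← kernelSeries_conj z]
  exact indicator_le_self _ _ _

lemma cutoffKernel_of_lt (S : L2a →L[ℂ] L2a) {r : ℝ} {z : 𝔻} (hz : r < ‖(z : ℂ)‖) (w : 𝔻) :
    cutoffKernel S r z w = ‖toFun (S (K z)) w‖ₑ := by
  rw [← inner_K, ← kernelSeries_conj w, ← kernelSeries_conj z]
  have hmem : ((z : ℂ), (w : ℂ)) ∈ (ball (0 : ℂ) 1 ∩ (closedBall 0 r)ᶜ) ×ˢ ball (0 : ℂ) 1 :=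
    ⟨⟨coe_mem_ball z, by simpa using hz⟩, coe_mem_ball w⟩
  exact indicator_of_mem hmem _

lemma cutoffKernel_of_le (S : L2a →L[ℂ] L2a) {r : ℝ} {z : ℂ} (hz : ‖z‖ ≤ r) (w : ℂ) :
    cutoffKernel S r z w = 0 :=
  indicator_of_notMem (fun h => h.1.2 (by simpa using hz)) _

/-- The Schur test for the part of `S` that lives near the boundary. -/
lemma lintegral_sq_cutoffKernel_le {S : L2a →L[ℂ] L2a} {r : ℝ} {A B : ℝ≥0∞}
    (hA : ∀ z : 𝔻, r < ‖(z : ℂ)‖ →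
      ∫⁻ w, ‖toFun (S (K z)) w‖ₑ * wt (1 / 2) w ∂dA ≤ A * wt (1 / 2) z)
    (hB : ∀ w : 𝔻, ∫⁻ z, ‖toFun (ContinuousLinearMap.adjoint S (K w)) z‖ₑ * wt (1 / 2) z ∂dA ≤
      B * wt (1 / 2) w) (f : L2a) :
    ∫⁻ w, (∫⁻ z, cutoffKernel S r z w * ‖toFun f z‖ₑ ∂dA) ^ 2 ∂dA ≤ A * B * ‖f‖ₑ ^ 2 := by
  classical
  let g : ℂ → ℝ≥0∞ := (ball (0 : ℂ) 1).indicator fun z => ‖toFun f z‖ₑ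
  have hg : Measurable g := by
    have := (toFun_diff f).continuousOn.enorm.measurable_piecewise (g := 0) continuousOn_const
      isOpen_ball.measurableSet
    rwa [Set.piecewise_eq_indicator] at this
  have hgf : g =ᵐ[dA] fun z => ‖toFun f z‖ₑ := by
    filter_upwards [ae_mem_ball] with z hz using indicator_of_mem hz _
  have h := lintegral_sq_le_of_schur (μ := dA) (ν := dA) (A := A) (B := B)
    (measurable_cutoffKernel S r) (measurable_wt (1 / 2)) (measurable_wt (1 / 2))
    (ae_mem_ball.mono fun z hz => wt_ne_zero _ hz) (ae_mem_ball.mono fun z hz => wt_ne_top _ hz)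
    (ae_mem_ball.mono fun z hz => ?_) (ae_mem_ball.mono fun w hw => ?_) hg
  · have e1 : ∀ w, ∫⁻ z, cutoffKernel S r z w * g z ∂dA =
        ∫⁻ z, cutoffKernel S r z w * ‖toFun f z‖ₑ ∂dA := fun w =>
      lintegral_congr_ae (hgf.mono fun z hz => by simp only [hz])
    have e2 : ∫⁻ z, g z ^ 2 ∂dA = ‖f‖ₑ ^ 2 := by
      rw [enorm_sq_eq_lintegral]
      exact lintegral_congr_ae (hgf.mono fun z hz => by simp only [hz])
    simpa only [e1, e2] using h
  -- The cutoff kernel vanishes for `|z| ≤ r`, so the constant `A` only has to serve `|z| > r`. That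
  -- is how smallness near the boundary enters.
  · by_cases hzr : ‖z‖ ≤ r
    · simp [cutoffKernel_of_le S hzr]
    · lift z to 𝔻 using mem_ball_zero_iff.1 hz
      refine le_trans (lintegral_mono_ae ?_) (hA z (not_le.1 hzr))
      filter_upwards [ae_mem_ball] with w hw
      lift w to 𝔻 using mem_ball_zero_iff.1 hw
      gcongr
      exact cutoffKernel_le S r z w
  · lift w to 𝔻 using mem_ball_zero_iff.1 hw
    refine le_trans (lintegral_mono_ae ?_) (hB w)
    filter_upwards [ae_mem_ball] with z hz
    lift z to 𝔻 using mem_ball_zero_iff.1 hz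
    gcongr
    rw [enorm_inner_K_comm]
    exact cutoffKernel_le S r z w

lemma integrable_conj_mul (f g : L2a) :
    Integrable (fun w => conj (toFun f w) * toFun g w) dA := by
  refine (L2.integrable_inner (𝕜 := ℂ) (f : Lp ℂ 2 dA) (g : Lp ℂ 2 dA)).congr ?_
  filter_upwards [toFun_ae f, toFun_ae g] with w h1 h2
  rw [h1, h2, RCLike.inner_apply, mul_comm]

/-- Up to a compact operator, `S` is an integral operator with kernel supported near the
boundary. -/
lemma exists_compact_enorm_sub_le (S : L2a →L[ℂ] L2a) {r : ℝ} (hr : r < 1) :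
    ∃ R : L2a →L[ℂ] L2a, IsCompactOperator R ∧ ∀ (f : L2a) (w : 𝔻),
      ‖toFun ((S - R) f) w‖ₑ ≤ ∫⁻ z, cutoffKernel S r z w * ‖toFun f z‖ₑ ∂dA := by
  obtain ⟨R, hR, hRi⟩ := exists_compact_integral_rankOne dA (isCompact_closedBall (0 : ℂ) r)
    (continuousOn_kernelSeries_conj.mono (closedBall_subset_ball hr))
  -- Composing `S` with the compact operator `R` keeps exactly the part over `|z| ≤ r` of `(S f)(w)
  -- = ∫ conj((S* K_w)(z)) f(z) dA(z)`, so the difference is the integral over the complement.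
  refine ⟨S ∘L R, hR.clm_comp S, fun f w => ?_⟩
  set h := ContinuousLinearMap.adjoint S (K w) with hh
  have e1 : toFun ((S - S ∘L R) f) w = inner ℂ h f - inner ℂ h (R f) := by
    rw [← inner_K, hh, ContinuousLinearMap.adjoint_inner_left,
      ContinuousLinearMap.adjoint_inner_left]
    exact inner_sub_right (𝕜 := ℂ) (K w) (S f) (S (R f))
  have e2 : inner ℂ h (R f) = ∫ z in closedBall (0 : ℂ) r, conj (toFun h z) * toFun f z ∂dA := by
    rw [hRi]
    refine setIntegral_congr_fun isClosed_closedBall.measurableSet fun z hz => ?_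
    have hz' : z ∈ ball (0 : ℂ) 1 := closedBall_subset_ball hr hz
    lift z to 𝔻 using mem_ball_zero_iff.1 hz'
    simp only [kernelSeries_conj]
    have hsymm : conj (inner ℂ (K z) h) = inner ℂ h (K z) := inner_conj_symm (𝕜 := ℂ) h (K z)
    rw [inner_K, ← inner_K z h, hsymm]
  have e3 : toFun ((S - S ∘L R) f) w =
      ∫ z in (closedBall (0 : ℂ) r)ᶜ, conj (toFun h z) * toFun f z ∂dA := by
    rw [e1, e2, inner_eq_integral,
      ← integral_add_compl isClosed_closedBall.measurableSet (integrable_conj_mul h f)]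
    ring
  rw [e3]
  refine (enorm_integral_le_lintegral_enorm _).trans ?_
  rw [← lintegral_indicator isClosed_closedBall.measurableSet.compl]
  refine lintegral_mono_ae ?_
  filter_upwards [ae_mem_ball] with z hz
  by_cases hzr : z ∈ (closedBall (0 : ℂ) r)ᶜ
  · rw [indicator_of_mem hzr, enorm_mul]
    lift z to 𝔻 using mem_ball_zero_iff.1 hz
    have e4 : ‖conj (toFun h z)‖ₑ = ‖toFun h z‖ₑ := by
      rw [← ofReal_norm, RCLike.norm_conj, ofReal_norm]
    rw [e4, hh, enorm_inner_K_comm, cutoffKernel_of_lt S (by simpa using hzr)]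
  · rw [indicator_of_notMem hzr]
    exact zero_le

lemma exists_radius_of_eventually {P : 𝔻 → Prop} (h : ∀ᶠ z in toBoundary, P z) :
    ∃ r < 1, ∀ z : 𝔻, r < ‖(z : ℂ)‖ → P z := by
  rw [toBoundary, eventually_comap] at h
  obtain ⟨ε, hε, hb⟩ := Metric.eventually_nhds_iff.1 h
  refine ⟨1 - ε, by linarith, fun z hz => hb (y := ‖(z : ℂ)‖) ?_ z rfl⟩
  rw [Real.dist_eq, abs_lt]
  constructor <;> linarith [z.norm_lt_one]

/-- If the `L⁶` norms of `S_z 1` vanish at the boundary, then `S` is compact. -/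
lemma isCompactOperator_of_tendsto_eLpNorm {S : L2a →L[ℂ] L2a}
    (hS : GrowthBounded (ContinuousLinearMap.adjoint S))
    (h : Tendsto (fun z => eLpNorm (conjBy S z one : Lp ℂ 2 dA) 6 dA) toBoundary (𝓝 0)) :
    IsCompactOperator S := by
  obtain ⟨C, hC, hK⟩ := exists_lintegral_comp_K_le
  obtain ⟨M, hM, hSM⟩ := hS.exists_eLpNorm_six_le
  refine isCompactOperator_of_forall_exists_norm_sub_le fun ε hε => ?_
  set B : ℝ≥0∞ := C * M with hBdef
  have hBt : B ≠ ∞ := ENNReal.mul_ne_top hC hM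
  set δ : ℝ≥0∞ := ENNReal.ofReal ε with hδ
  have hδ0 : δ ≠ 0 := by rw [hδ]; simpa using hε
  -- The Schur test bounds the squared norm by `A B`, so this choice gives operator norm at most
  -- `ε`. The `+ 1` guards against `B = 0`.
  set A : ℝ≥0∞ := δ ^ 2 / (B + 1) with hAdef
  have hB1 : B + 1 ≠ ∞ := ENNReal.add_ne_top.2 ⟨hBt, ENNReal.one_ne_top⟩
  have hA0 : 0 < A := ENNReal.div_pos (pow_ne_zero 2 hδ0) hB1
  have hAB : A * B ≤ δ ^ 2 :=
    calc A * B ≤ A * (B + 1) := by gcongr; exact le_self_add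
      _ ≤ δ ^ 2 := by rw [hAdef, ENNReal.div_mul_cancel (by simp) hB1]
  have ht : Tendsto (fun z => C * eLpNorm (toFun (conjBy S z one)) 6 dA) toBoundary (𝓝 0) := by
    simp only [eLpNorm_coe] at h
    simpa using ENNReal.Tendsto.const_mul h (.inr hC)
  obtain ⟨r, hr, hrA⟩ := exists_radius_of_eventually (ht.eventually_le_const hA0)
  obtain ⟨R, hR, hRle⟩ := exists_compact_enorm_sub_le S hr
  refine ⟨R, hR, fun f => ?_⟩
  have h1 : ‖(S - R) f‖ₑ ^ 2 ≤ (δ * ‖f‖ₑ) ^ 2 := by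
    rw [enorm_sq_eq_lintegral, mul_pow]
    calc _ ≤ ∫⁻ w, (∫⁻ z, cutoffKernel S r z w * ‖toFun f z‖ₑ ∂dA) ^ 2 ∂dA := by
          refine lintegral_mono_ae ?_
          filter_upwards [ae_mem_ball] with w hw
          lift w to 𝔻 using mem_ball_zero_iff.1 hw
          exact pow_le_pow_left₀ zero_le (hRle f w) 2
      _ ≤ A * B * ‖f‖ₑ ^ 2 := by
          refine lintegral_sq_cutoffKernel_le (fun z hz => (hK S z).trans ?_)
            (fun w => (hK _ w).trans ?_) f
          · gcongr
            exact hrA z hz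
          · rw [hBdef]
            gcongr
            exact hSM w
      _ ≤ _ := by gcongr
  have h2 : ‖(S - R) f‖ₑ ≤ δ * ‖f‖ₑ := (ENNReal.pow_le_pow_left_iff two_ne_zero).1 h1
  rw [hδ, ← ofReal_norm, ← ofReal_norm, ← ENNReal.ofReal_mul (by positivity)] at h2
  exact (ENNReal.ofReal_le_ofReal_iff (by positivity)).1 h2

lemma tendsto_berezin_of_tendsto_norm {S : L2a →L[ℂ] L2a}
    (h : Tendsto (fun z => ‖S (k z)‖) toBoundary (𝓝 0)) :
    Tendsto (fun z => berezin S z) toBoundary (𝓝 0) := by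
  refine squeeze_zero_norm (fun z => ?_) h
  have h1 : ‖berezin S z‖ ≤ ‖k z‖ * ‖S (k z)‖ := norm_inner_le_norm (𝕜 := ℂ) (k z) (S (k z))
  rwa [norm_k, one_mul] at h1

lemma tendsto_norm_of_tendsto_eLpNorm_two {α : Type*} {l : Filter α} {f : α → L2a}
    (h : Tendsto (fun z => eLpNorm (f z : Lp ℂ 2 dA) 2 dA) l (𝓝 0)) :
    Tendsto (fun z => ‖f z‖) l (𝓝 0) := by
  have h1 := (ENNReal.tendsto_toReal ENNReal.zero_ne_top).comp h
  refine h1.congr fun z => ?_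
  rw [Function.comp, eLpNorm_coe, eLpNorm_toFun]

end Bergman

theorem mainTheorem1 (m : ℕ) (n : Fin m → ℕ) (u : (i : Fin m) → Fin (n i) → Lp ℂ ∞ Bergman.dA)
    (S : Bergman.L2a →L[ℂ] Bergman.L2a)
    (hS : S = ∑ i, (List.ofFn fun j => Bergman.toeplitz (u i j)).prod) :
    List.TFAE [
      IsCompactOperator S,
      Tendsto (fun z => ‖S (Bergman.k z)‖) Bergman.toBoundary (𝓝 0),
      Tendsto (fun z => Bergman.berezin S z) Bergman.toBoundary (𝓝 0),
      Tendsto (fun z => toWeakSpace ℂ Bergman.L2a (Bergman.conjBy S z Bergman.one))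
        Bergman.toBoundary (𝓝 0),
      Tendsto (fun z => ‖Bergman.conjBy S z Bergman.one‖) Bergman.toBoundary (𝓝 0),
      ∀ p : ℝ≥0∞, 1 < p → p < ∞ →
        Tendsto (fun z => eLpNorm (Bergman.conjBy S z Bergman.one : Lp ℂ 2 Bergman.dA) p Bergman.dA)
          Bergman.toBoundary (𝓝 0)] := by
  have hgrowth : Bergman.GrowthBounded S ∧
      Bergman.GrowthBounded (ContinuousLinearMap.adjoint S) := by
    rw [hS]
    refine Bergman.growthBounded_sum _ _ fun i => ?_
    have := Bergman.growthBounded_list_prod (List.ofFn (u i))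
    rwa [List.map_ofFn] at this
  tfae_have 1 → 2 := Bergman.tendsto_norm_comp_k_of_compact
  tfae_have 2 → 3 := Bergman.tendsto_berezin_of_tendsto_norm
  tfae_have 3 → 4 := Bergman.tendsto_toWeakSpace_conjBy_one
  tfae_have 4 → 6 := fun h p hp1 hp => hgrowth.1.tendsto_eLpNorm h hp1 hp
  tfae_have 6 → 1 := fun h =>
    Bergman.isCompactOperator_of_tendsto_eLpNorm hgrowth.2 (h 6 (by norm_num) (by norm_num))
  tfae_have 6 → 5 := fun h =>
    Bergman.tendsto_norm_of_tendsto_eLpNorm_two (h 2 (by norm_num) (by norm_num))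
  tfae_have 5 → 2 := fun h => by simpa only [Bergman.norm_conjBy_one] using h
  tfae_finish
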